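/- Let $d\ge 1$, let $1\le k\le n$, and let $V=V_d$ be a real $n\times d$ matrix of rank $d$ (for instance $V_d=[\sqrt{\lambda_1}\,v_1\ \cdots\ \sqrt{\lambda_d}\,v_d]$ for the $d$ leading eigenpairs, $\lambda_d>0$, of a positive semidefinite matrix), and put $A_d=VV^T$. Assume that $V$ is in general position: for no $c\ne 0$ do $d+1$ distinct coordinates of $Vc$ have the same absolute value. The Spannogram algorithm considers every $d$-element set of indices $i_1<\dots<i_d$ and every $(b_1,\dots,b_{d-1})\in\{\pm1\}^{d-1}$, computes a vector $c$ spanning the null space of the system $(Vc)_{i_1}=b_j(Vc)_{i_{j+1}}$, $1\le j\le d-1$, sorts all indices by decreasing $|(Vc)_i|$, and outputs the set $\mathcal J$ of the first $k$ indices; if $r=|\mathcal J\cap\{i_1,\dots,i_d\}|<d$, it also outputs, for every $r$-element subset $\mathcal M$ of $\{i_1,\dots,i_d\}$, the union of $\mathcal M$ and the first $k-r$ indices. Let $\mathcal S_d$ be the set of all sets that are output. Then: (a) $\mathcal S_d$ is exactly the set of all $k$-element sets $\mathcal I$ for which there is a unit vector $c\in\mathbb R^d$ such that $\mathcal I$ consists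 of the indices of $k$ largest absolute values of entries of $Vc$ (with ties broken in any way). (b) $\mathcal S_d$ contains the optimal $k$-support for $A_d$: if $x$ maximizes $x^TA_dx$ over all $x\in\mathbb R^n$ with $\|x\|_2=1$ and exactly $k$ nonzero entries, then the support of $x$ belongs to $\mathcal S_d$. Moreover (whether or not that maximum is attained) there are $\mathcal I\in\mathcal S_d$ and a unit vector $x$ with support contained in $\mathcal I$ that maximizes $x^TA_dx$ over all unit vectors with at most $k$ nonzero entries. (c) $|\mathcal S_d|\le 2^{d-1}\binom{d}{\lceil d/2\rceil}\binom nd$ and $|\mathcal S_d|\le 2^{2d}\binom nd$; in particular $|\mathcal S_d|\le C_d\,n^d$ with a constant $C_d$ that depends only on $d$. (d) There is a constant $C'_d$ that depends only on $d$ such that for all $n\ge 2$ the algorithm builds $\mathcal S_d$ in at most $C'_d\,n^{d+1}\log n$ steps, where arithmetic operations and comparisons on reals and indices, memory accesses, and elementary list operations cost one step each. -/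

import Mathlib

open Matrix

/-! ### Step counting on a real random-access machine

`Timed α` is a computation that returns a value and the number of steps it has used.
One step is: an arithmetic operation on reals or on indices, a comparison, reading or writing one
entry of an array, or one call of a list function (which pays for the pattern match and the
constant number of list cells built in that call). Sequencing adds up the steps. -/

/-- A result together with the number of steps spent on it. -/
structure Timed (α : Type) where
  /-- the result -/
  val : α
  /-- the number of steps -/
  cost : ℕ

instance : Monad Timed where
  pure a := ⟨a, 0⟩
  bind x f := ⟨(f x.val).val, x.cost + (f x.val).cost⟩

namespace Timed

/-- One elementary operation with result `a`. -/
def step {α : Type} (a : α) : Timed α := ⟨a, 1⟩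

/-- The loop that fills an array of length `m`, the `i`-th entry being computed by `f i`. -/
def array {α : Type} {m : ℕ} (f : Fin m → Timed α) : Timed (Fin m → α) :=
  ⟨fun i => (f i).val, 1 + ∑ i, ((f i).cost + 1)⟩

/-- The loop that adds up the `m` reals computed by `f 0, …, f (m - 1)`
(one addition and one step of loop control for each of them). -/
def sumLoop {m : ℕ} (f : Fin m → Timed ℝ) : Timed ℝ :=
  ⟨∑ i, (f i).val, 1 + ∑ i, ((f i).cost + 2)⟩

/-- The list `[0, …, n - 1]` of all indices. -/
def indices (n : ℕ) : Timed (List (Fin n)) := ⟨List.finRange n, n + 1⟩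

/-- The entries of an array, as a list. -/
def toList {α : Type} {m : ℕ} (t : Fin m → α) : Timed (List α) := ⟨List.ofFn t, m + 1⟩

def length {α : Type} : List α → Timed ℕ
  | [] => step 0
  | _ :: l => do
    let n ← length l
    step (n + 1)

def append {α : Type} : List α → List α → Timed (List α)
  | [], l' => step l'
  | x :: l, l' => do
    let r ← append l l'
    step (x :: r)

def map {α β : Type} (f : α → Timed β) : List α → Timed (List β)
  | [] => step []
  | x :: l => do
    let y ← f x
    let r ← map f l
    step (y :: r)

def flatMap {α β : Type} (f : α → Timed (List β)) : List α → Timed (List β)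
  | [] => step []
  | x :: l => do
    let y ← f x
    let r ← flatMap f l
    let s ← append y r
    step s

/-- The first `k` entries of a list. -/
def take {α : Type} : ℕ → List α → Timed (List α)
  | 0, _ => step []
  | _ + 1, [] => step []
  | k + 1, x :: l => do
    let r ← take k l
    step (x :: r)

/-- Is `x` an entry of the list? -/
def mem {n : ℕ} (x : Fin n) : List (Fin n) → Timed Bool
  | [] => step false
  | y :: l => do
    let e ← step (decide (x = y))
    if e then step true else do
      let r ← mem x l
      step r

/-- The number of entries of the second list that occur in the first one. -/
def countIn {n : ℕ} (T : List (Fin n)) : List (Fin n) → Timed ℕ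
  | [] => step 0
  | x :: l => do
    let e ← mem x T
    let r ← countIn T l
    if e then step (r + 1) else step r

/-! ### Sorting -/

/-- Merges two lists of (key, index) pairs, larger keys first. -/
noncomputable def merge {n : ℕ} : List (ℝ × Fin n) → List (ℝ × Fin n) → Timed (List (ℝ × Fin n))
  | [], l' => step l'
  | x :: l, [] => step (x :: l)
  | x :: l, y :: l' => do
    let e ← step (decide (y.1 ≤ x.1))
    if e then do
      let r ← merge l (y :: l')
      step (x :: r)
    else do
      let r ← merge (x :: l) l'
      step (y :: r)
termination_by l l' => l.length + l'.length

/-- Splits a list into two halves. -/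
def split {α : Type} : List α → Timed (List α × List α)
  | [] => step ([], [])
  | [x] => step ([x], [])
  | x :: y :: l => do
    let p ← split l
    step (x :: p.1, y :: p.2)

/-- Merge sort; the first argument bounds the depth of the recursion. -/
noncomputable def mergeSort {n : ℕ} : ℕ → List (ℝ × Fin n) → Timed (List (ℝ × Fin n))
  | _, [] => step []
  | _, [x] => step [x]
  | 0, l => step l
  | f + 1, l => do
    let p ← split l
    let a ← mergeSort f p.1
    let b ← mergeSort f p.2
    let r ← merge a b
    step r

/-- Sorts (key, index) pairs by decreasing key. -/
noncomputable def sort {n : ℕ} (l : List (ℝ × Fin n)) : Timed (List (ℝ × Fin n)) := do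
  let f ← length l
  mergeSort f l

/-! ### Linear algebra -/

/-- Attaches the sign `(-1) ^ j` to `x`. -/
noncomputable def signed (j : ℕ) (x : ℝ) : Timed ℝ := do
  let e ← step (decide (j % 2 = 0))
  if e then step x else step (-x)

/-- The determinant of an `m × m` array, by expansion along the first row. -/
noncomputable def det : (m : ℕ) → (Fin m → Fin m → ℝ) → Timed ℝ
  | 0, _ => step 1
  | m + 1, M => sumLoop fun j => do
    let N ← array fun i => array fun l => do
      let q ← step (j.succAbove l)
      step (M i.succ q)
    let x ← det m N
    let y ← step (M 0 j)
    let z ← step (y * x)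
    signed j z

/-- The vector of signed maximal minors of an `m × (m + 1)` array. It is orthogonal to every row,
and it spans the null space as soon as the null space has dimension one. -/
noncomputable def nullVector {m : ℕ} (M : Fin m → Fin (m + 1) → ℝ) : Timed (Fin (m + 1) → ℝ) :=
  array fun j => do
    let N ← array fun i => array fun l => do
      let q ← step (j.succAbove l)
      step (M i q)
    let x ← det m N
    signed j x

/-! ### Enumeration -/

/-- The array with first entry `x` and remaining entries `t`. -/
def consArray {α : Type} {m : ℕ} (x : α) (t : Fin m → α) : Timed (Fin (m + 1) → α) :=
  array fun i => step ((Fin.cons x t : Fin (m + 1) → α) i)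

/-- All `m`-element subsequences of a list. -/
def choose {α : Type} : (m : ℕ) → List α → Timed (List (Fin m → α))
  | 0, _ => step [Fin.elim0]
  | _ + 1, [] => step []
  | m + 1, x :: l => do
    let s ← choose m l
    let s' ← map (consArray x) s
    let u ← choose (m + 1) l
    let r ← append s' u
    step r

/-- All sequences in `{1, -1} ^ m`. -/
noncomputable def signs : (m : ℕ) → Timed (List (Fin m → ℝ))
  | 0 => step [Fin.elim0]
  | m + 1 => do
    let s ← signs m
    let p ← map (consArray 1) s
    let q ← map (consArray (-1)) s
    let r ← append p q
    step r

end Timed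

open Timed in
/-- The body of the double loop of the Spannogram algorithm, for the indices `t 0 < ⋯ < t m` and the
signs `b`, where `d = m + 1`: solve `(V c)_{t 0} = b_j (V c)_{t (j + 1)}`, sort the indices by
decreasing `|(V c)_i|`, keep the first `k` of them, and, if only `r < d` of the indices `t` have been
kept, add the first `k - r` indices together with any `r` of the indices `t`. -/
noncomputable def spannogramBody {n m : ℕ} (V : Matrix (Fin n) (Fin (m + 1)) ℝ) (k : ℕ)
    (t : Fin (m + 1) → Fin n) (b : Fin m → ℝ) : Timed (List (List (Fin n))) := do
  let M ← array fun j => array fun l => do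
    let x ← step (V (t 0) l)
    let y ← step (V (t j.succ) l)
    let z ← step (b j * y)
    step (x - z)
  let c ← nullVector M
  let is ← indices n
  let keys ← map (fun i => do
    let x ← sumLoop fun l => do
      let y ← step (V i l)
      let z ← step (c l)
      step (y * z)
    let a ← step |x|
    step (a, i)) is
  let sorted ← sort keys
  let I ← map (fun p => step p.2) sorted
  let J₁ ← take k I
  let T ← toList t
  let r ← countIn T J₁
  let e ← step (decide (r < m + 1))
  if e then do
    let q ← step (k - r)
    let top ← take q I
    let Ms ← choose r T
    let Js ← map (fun M => do
      let L ← toList M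
      append top L) Ms
    step (J₁ :: Js)
  else step [J₁]

open Timed in
/-- The Spannogram algorithm (for matrices with entries of arbitrary sign): run the body over all
`d`-element subsets of the `n` indices and all sign sequences in `{1, -1} ^ (d - 1)`, and collect the
candidate supports. Each support is a list of indices. For `d = 0` there is nothing to do. -/
noncomputable def spannogram {n : ℕ} :
    {d : ℕ} → Matrix (Fin n) (Fin d) ℝ → ℕ → Timed (List (List (Fin n)))
  | 0, _, _ => step []
  | m + 1, V, k => do
    let is ← indices n
    let ts ← choose (m + 1) is
    let bs ← signs m
    flatMap (fun t => flatMap (fun b => spannogramBody V k t b) bs) ts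

/-- The candidate set `S_d`: the set of all supports that the Spannogram algorithm outputs. -/
noncomputable def candidateSet {n d : ℕ} (V : Matrix (Fin n) (Fin d) ℝ) (k : ℕ) :
    Finset (Finset (Fin n)) :=
  ((spannogram V k).val.map List.toFinset).toFinset

/-- The number of steps of the Spannogram algorithm. -/
noncomputable def spannogramTime {n d : ℕ} (V : Matrix (Fin n) (Fin d) ℝ) (k : ℕ) : ℕ :=
  (spannogram V k).cost

/-! ### The sparse optimization problem -/

/-- `I` consists of the indices of `k` largest absolute values of `v` (with ties broken in
some way). -/
def IsTopK {n : ℕ} (k : ℕ) (v : Fin n → ℝ) (I : Finset (Fin n)) : Prop :=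
  I.card = k ∧ ∀ i ∈ I, ∀ j ∉ I, |v j| ≤ |v i|

/-- No `d + 1` of the hypersurfaces `c ↦ |(V c)_i|` meet at a common point `c ≠ 0`. -/
def InGeneralPosition {n d : ℕ} (V : Matrix (Fin n) (Fin d) ℝ) : Prop :=
  ∀ t : Fin (d + 1) → Fin n, Function.Injective t → ∀ c : Fin d → ℝ, c ≠ 0 →
    ¬ ∀ i, |(V *ᵥ c) (t i)| = |(V *ᵥ c) (t 0)|

/-- The set of indices of the nonzero entries of `x`. -/
noncomputable def suppOf {n : ℕ} (x : Fin n → ℝ) : Finset (Fin n) :=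
  Finset.univ.filter fun i => x i ≠ 0

/-- The vectors of Euclidean norm one with exactly `k` nonzero entries. -/
def sparseSphere (n k : ℕ) : Set (Fin n → ℝ) :=
  {x | x ⬝ᵥ x = 1 ∧ (suppOf x).card = k}

/-- The quadratic form `xᵀ A x`. -/
noncomputable def quadForm {n : ℕ} (A : Matrix (Fin n) (Fin n) ℝ) (x : Fin n → ℝ) : ℝ :=
  x ⬝ᵥ (A *ᵥ x)

/-! For the characterization, fix a set I of `k` largest entries of |Vc| and rescale so that the
entries in I have absolute value at least 1 and the others at most 1. As long as fewer than d
entries lie exactly on the level 1, some direction u freezes those entries. Since V has full column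
rank, u moves another entry, and travelling along u makes a further entry reach the level. This ends
at a vector with d tied entries at the boundary of I (`exists_threshold_add_active`,
`exists_vertex`). The rescaling fails when I contains a zero entry; `exists_tie` handles that case
by a perturbation or by a tie at level zero.

Each such vector is a multiple of one the algorithm computes. Its d ties give a sign vector b, and
general position makes the null space of the tie system one-dimensional, spanned by the signed
minors (`nullVector_tieMatrix_ne_zero`, `eq_smul_nullVector`). General position also makes the level
set of the ties exactly the chosen d-element set T. Let U be the set of indices strictly above that
level. If the cut after `k` entries falls strictly inside T, the output is the family of all U ∪ M
with M ⊆ T of the right size; otherwise it is a single sorted prefix. In both cases every output is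
a set of `k` largest entries, and every such set with this level as threshold is output. The same
description bounds the output per system by a middle binomial coefficient, hence the count.

For the optimization, put w = V Vᵀ x for an optimal x. The form q(x) is positive, and Cauchy–Schwarz
for Vᵀx and Vᵀy shows that any y in the feasible set satisfies y · w ≤ q(x) = x · w. So the support
of x must consist of `k` largest entries of w, and w lies in the span of V. For at most `k` nonzero
entries an optimum exists by compactness, and truncating w to `k` largest entries gives another one.

For the running time, all linear algebra has size depending on d alone, so each pass of the double
loop is dominated by sorting `n` keys, and there are at most 2^(d-1) n^d passes. -/

namespace Timed

/-! ### Results of the timed operations -/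

@[simp] theorem bind_val {α β : Type} (x : Timed α) (f : α → Timed β) :
    (x >>= f).val = (f x.val).val := rfl

@[simp] theorem bind_cost {α β : Type} (x : Timed α) (f : α → Timed β) :
    (x >>= f).cost = x.cost + (f x.val).cost := rfl

@[simp] theorem step_val {α : Type} (a : α) : (step a).val = a := rfl

@[simp] theorem step_cost {α : Type} (a : α) : (step a).cost = 1 := rfl

@[simp] theorem array_val {α : Type} {m : ℕ} (f : Fin m → Timed α) :
    (array f).val = fun i => (f i).val := rfl

theorem array_cost {α : Type} {m : ℕ} (f : Fin m → Timed α) :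
    (array f).cost = 1 + ∑ i, ((f i).cost + 1) := rfl

@[simp] theorem sumLoop_val {m : ℕ} (f : Fin m → Timed ℝ) :
    (sumLoop f).val = ∑ i, (f i).val := rfl

theorem sumLoop_cost {m : ℕ} (f : Fin m → Timed ℝ) :
    (sumLoop f).cost = 1 + ∑ i, ((f i).cost + 2) := rfl

@[simp] theorem indices_val (n : ℕ) : (indices n).val = List.finRange n := rfl

@[simp] theorem indices_cost (n : ℕ) : (indices n).cost = n + 1 := rfl

@[simp] theorem toList_val {α : Type} {m : ℕ} (t : Fin m → α) :
    (toList t).val = List.ofFn t := rfl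

@[simp] theorem toList_cost {α : Type} {m : ℕ} (t : Fin m → α) : (toList t).cost = m + 1 := rfl

theorem apply_ite_val {α : Type} (p : Prop) [Decidable p] (x y : Timed α) :
    (if p then x else y).val = if p then x.val else y.val := apply_ite _ _ _ _

@[simp] theorem length_val {α : Type} (l : List α) : (length l).val = l.length := by
  induction l with
  | nil => rfl
  | cons x l ih => simp [length, ih]

@[simp] theorem append_val {α : Type} (l l' : List α) : (append l l').val = l ++ l' := by
  induction l with
  | nil => rfl
  | cons x l ih => simp [append, ih]

@[simp] theorem map_val {α β : Type} (f : α → Timed β) (l : List α) :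
    (map f l).val = l.map fun x => (f x).val := by
  induction l with
  | nil => rfl
  | cons x l ih => simp [map, ih]

@[simp] theorem flatMap_val {α β : Type} (f : α → Timed (List β)) (l : List α) :
    (flatMap f l).val = l.flatMap fun x => (f x).val := by
  induction l with
  | nil => rfl
  | cons x l ih => simp [flatMap, ih]

@[simp] theorem take_val {α : Type} (k : ℕ) (l : List α) : (take k l).val = l.take k := by
  induction k generalizing l with
  | zero => simp [take]
  | succ k ih => cases l <;> simp [take, ih]

@[simp] theorem mem_val {n : ℕ} (x : Fin n) (l : List (Fin n)) :
    (mem x l).val = decide (x ∈ l) := by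
  induction l with
  | nil => rfl
  | cons y l ih =>
    by_cases h : x = y <;> simp [mem, ih, h]

@[simp] theorem countIn_val {n : ℕ} (T l : List (Fin n)) :
    (countIn T l).val = l.countP fun x => decide (x ∈ T) := by
  induction l with
  | nil => rfl
  | cons y l ih =>
    by_cases h : y ∈ T <;> simp [countIn, ih, h]

theorem merge_perm {n : ℕ} (l l' : List (ℝ × Fin n)) : (merge l l').val.Perm (l ++ l') := by
  fun_induction merge l l' with
  | case1 l' => simp
  | case2 x l => simp
  | case3 x l y l' ih1 ih2 =>
    by_cases h : y.1 ≤ x.1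
    · simpa [h] using ih1
    · simp only [bind_val, step_val, h, decide_false, Bool.false_eq_true, if_false]
      refine (ih2.cons y).trans ?_
      exact List.perm_middle.symm

theorem merge_sorted {n : ℕ} (l l' : List (ℝ × Fin n))
    (hl : l.Pairwise fun p q => q.1 ≤ p.1) (hl' : l'.Pairwise fun p q => q.1 ≤ p.1) :
    (merge l l').val.Pairwise fun p q => q.1 ≤ p.1 := by
  fun_induction merge l l' with
  | case1 l' => exact hl'
  | case2 x l => exact hl
  | case3 x l y l' ih1 ih2 =>
    have hx := List.pairwise_cons.1 hl
    have hy := List.pairwise_cons.1 hl'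
    by_cases h : y.1 ≤ x.1
    · simp only [bind_val, step_val, h, decide_true, if_true, List.pairwise_cons]
      refine ⟨fun q hq => ?_, ih1 hx.2 hl'⟩
      rcases List.mem_append.1 ((merge_perm _ _).mem_iff.1 hq) with hq | hq
      · exact hx.1 q hq
      · rcases List.mem_cons.1 hq with rfl | hq
        · exact h
        · exact (hy.1 q hq).trans h
    · simp only [bind_val, step_val, h, decide_false, Bool.false_eq_true, if_false,
        List.pairwise_cons]
      refine ⟨fun q hq => ?_, ih2 hl hy.2⟩
      rcases List.mem_append.1 ((merge_perm _ _).mem_iff.1 hq) with hq | hq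
      · rcases List.mem_cons.1 hq with rfl | hq
        · exact (not_le.1 h).le
        · exact (hx.1 q hq).trans (not_le.1 h).le
      · exact hy.1 q hq

theorem split_perm {α : Type} (l : List α) : ((split l).val.1 ++ (split l).val.2).Perm l := by
  fun_induction split l with
  | case1 => simp
  | case2 x => simp
  | case3 x y l ih =>
    simp only [bind_val, step_val, List.cons_append, List.perm_cons]
    exact List.perm_middle.trans (ih.cons y)

theorem split_length {α : Type} (l : List α) :
    (split l).val.1.length = (l.length + 1) / 2 ∧ (split l).val.2.length = l.length / 2 := by
  fun_induction split l with
  | case1 => simp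
  | case2 x => simp
  | case3 x y l ih =>
    simp only [bind_val, step_val, List.length_cons, ih.1, ih.2]
    omega

theorem mergeSort_perm {n : ℕ} (f : ℕ) (l : List (ℝ × Fin n)) : (mergeSort f l).val.Perm l := by
  fun_induction mergeSort f l with
  | case1 => simp
  | case2 => simp
  | case3 => simp
  | case4 f l _ _ ih1 ih2 =>
    simp only [bind_val, step_val]
    exact ((merge_perm _ _).trans ((ih1 _).append (ih2 _))).trans (split_perm l)

/-- The halves of a list with at least two entries are strictly shorter, so depth `f` suffices for
`f + 1` entries and the unsorted fallback at depth 0 only meets trivial lists. -/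
theorem mergeSort_sorted {n : ℕ} (f : ℕ) (l : List (ℝ × Fin n)) (h : l.length ≤ f + 1) :
    (mergeSort f l).val.Pairwise fun p q => q.1 ≤ p.1 := by
  fun_induction mergeSort f l with
  | case1 => simp
  | case2 => simp
  | case3 l h0 h1 =>
    match l, h0, h1, h with
    | [], h0, _, _ => simp
    | [x], _, h1, _ => simp
  | case4 f l h0 h1 ih1 ih2 =>
    simp only [bind_val, step_val]
    obtain ⟨e1, e2⟩ := split_length l
    exact merge_sorted _ _ (ih1 _ (by omega)) (ih2 _ (by omega))

theorem sort_perm {n : ℕ} (l : List (ℝ × Fin n)) : (sort l).val.Perm l := mergeSort_perm _ _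

theorem sort_sorted {n : ℕ} (l : List (ℝ × Fin n)) :
    (sort l).val.Pairwise fun p q => q.1 ≤ p.1 := mergeSort_sorted _ _ (by simp)

@[simp] theorem signed_val (j : ℕ) (x : ℝ) : (signed j x).val = (-1) ^ j * x := by
  rcases Nat.mod_two_eq_zero_or_one j with h | h
  · simp [signed, h, (Nat.even_iff.2 h).neg_one_pow]
  · simp [signed, h, (Nat.odd_iff.2 h).neg_one_pow]

@[simp] theorem det_val (m : ℕ) (M : Fin m → Fin m → ℝ) : (det m M).val = (Matrix.of M).det := by
  induction m with
  | zero => simp [det]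
  | succ m ih =>
    rw [Matrix.det_succ_row_zero]
    simp only [det, sumLoop_val, bind_val, signed_val, step_val, array_val, ih, mul_assoc]
    rfl

theorem nullVector_val {m : ℕ} (M : Fin m → Fin (m + 1) → ℝ) (j : Fin (m + 1)) :
    (nullVector M).val j = (-1) ^ (j : ℕ) * ((Matrix.of M).submatrix id j.succAbove).det := by
  simp only [nullVector, array_val, bind_val, signed_val, det_val, step_val]
  rfl

@[simp] theorem consArray_val {α : Type} {m : ℕ} (x : α) (t : Fin m → α) :
    (consArray x t).val = Fin.cons x t := rfl

theorem choose_length {α : Type} (m : ℕ) (l : List α) :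
    (choose m l).val.length = l.length.choose m := by
  fun_induction choose m l with
  | case1 => simp
  | case2 => simp
  | case3 m x l ih1 ih2 => simp [ih1, ih2, Nat.choose_succ_succ]

theorem mem_choose {α : Type} (m : ℕ) (l : List α) (t : Fin m → α) :
    t ∈ (choose m l).val ↔ (List.ofFn t).Sublist l := by
  fun_induction choose m l with
  | case1 => simp [Subsingleton.elim t Fin.elim0]
  | case2 => simp
  | case3 m x l ih1 ih2 =>
    simp only [bind_val, step_val, append_val, map_val, consArray_val, List.mem_append,
      List.mem_map, ih1, ih2]
    constructor
    · rintro (⟨s, hs, rfl⟩ | h)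
      · simpa [List.ofFn_succ] using hs
      · exact h.cons x
    · intro h
      rw [List.ofFn_succ] at h ⊢
      rcases List.sublist_cons_iff.1 h with h | ⟨r, hr, h⟩
      · exact Or.inr h
      · obtain ⟨h0, h1⟩ := List.cons.inj hr
        refine Or.inl ⟨fun i => t i.succ, h1 ▸ h, ?_⟩
        rw [← h0]
        exact Fin.cons_self_tail t

theorem signs_length (m : ℕ) : (signs m).val.length = 2 ^ m := by
  induction m with
  | zero => simp [signs]
  | succ m ih => simp [signs, ih, pow_succ, mul_two]

theorem mem_signs (m : ℕ) (b : Fin m → ℝ) :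
    b ∈ (signs m).val ↔ ∀ j, b j = 1 ∨ b j = -1 := by
  induction m with
  | zero => simp [signs, Subsingleton.elim b Fin.elim0]
  | succ m ih =>
    simp only [signs, bind_val, step_val, append_val, map_val, consArray_val, List.mem_append,
      List.mem_map, ih]
    constructor
    · rintro (⟨s, hs, rfl⟩ | ⟨s, hs, rfl⟩) <;> refine Fin.cases ?_ ?_ <;> simp [hs]
    · intro h
      rcases h 0 with h0 | h0
      · exact Or.inl ⟨Fin.tail b, fun j => h j.succ, by rw [← h0]; exact Fin.cons_self_tail b⟩
      · exact Or.inr ⟨Fin.tail b, fun j => h j.succ, by rw [← h0]; exact Fin.cons_self_tail b⟩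

/-- The `m`-element subsets of a list without repetitions are the supports of the subsequences
that `choose` enumerates. -/
theorem exists_mem_choose_iff {α : Type} [DecidableEq α] {m : ℕ} {l : List α} (hl : l.Nodup)
    (S : Finset α) :
    (∃ t ∈ (choose m l).val, (List.ofFn t).toFinset = S) ↔ S ⊆ l.toFinset ∧ S.card = m := by
  simp only [mem_choose]
  constructor
  · rintro ⟨t, ht, rfl⟩
    refine ⟨fun x hx => ?_, ?_⟩
    · simpa using ht.subset (List.mem_toFinset.1 hx)
    · rw [List.toFinset_card_of_nodup (ht.nodup hl), List.length_ofFn]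
  · rintro ⟨hS, hm⟩
    have e : (l.filter (· ∈ S)).toFinset = S := by
      ext x
      have := @hS x
      simp at this ⊢
      exact this
    have hlen : (l.filter (· ∈ S)).length = m := by
      rw [← hm, ← List.toFinset_card_of_nodup (hl.filter _), e]
    subst hlen
    exact ⟨fun i => (l.filter (· ∈ S)).get i, by simp, by
      simpa [List.ofFn_get] using e⟩

theorem injective_of_mem_choose {α : Type} {m : ℕ} {l : List α} (hl : l.Nodup)
    {t : Fin m → α} (ht : t ∈ (choose m l).val) : Function.Injective t :=
  List.nodup_ofFn.1 (((mem_choose m l t).1 ht).nodup hl)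

end Timed

/-! ### Output of one pass of the double loop -/

open Timed in
/-- The candidate supports built from the list `L` of all indices in sorted order, where `r` of the
indices `t` are among the first `k`. -/
def candidateLists {n m : ℕ} (t : Fin (m + 1) → Fin n) (k : ℕ) (L : List (Fin n)) (r : ℕ) :
    List (List (Fin n)) :=
  if r < m + 1 then
    L.take k :: (choose r (List.ofFn t)).val.map fun M => L.take (k - r) ++ List.ofFn M
  else [L.take k]

/-- The matrix of the system `(V c)_{t 0} = b_j (V c)_{t (j + 1)}`. -/
def tieMatrix {n m : ℕ} (V : Matrix (Fin n) (Fin (m + 1)) ℝ) (t : Fin (m + 1) → Fin n)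
    (b : Fin m → ℝ) : Fin m → Fin (m + 1) → ℝ :=
  fun j l => V (t 0) l - b j * V (t j.succ) l

-- Only the fact that `L` is some decreasing order of the indices is recorded; how the sort breaks
-- ties plays no role later.
open Timed in
theorem spannogramBody_val {n m : ℕ} (V : Matrix (Fin n) (Fin (m + 1)) ℝ) (k : ℕ)
    (t : Fin (m + 1) → Fin n) (b : Fin m → ℝ) :
    ∃ L : List (Fin n), L.Perm (List.finRange n) ∧
      L.Pairwise (fun i j => |(V *ᵥ (nullVector (tieMatrix V t b)).val) j| ≤
        |(V *ᵥ (nullVector (tieMatrix V t b)).val) i|) ∧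
      (spannogramBody V k t b).val = candidateLists t k L
        ((L.take k).countP fun x => decide (x ∈ List.ofFn t)) := by
  set c := (nullVector (tieMatrix V t b)).val with hc
  set keys : List (ℝ × Fin n) := (List.finRange n).map fun i => (|(V *ᵥ c) i|, i) with hkeys
  have hperm := sort_perm keys
  refine ⟨(sort keys).val.map Prod.snd, ?_, ?_, ?_⟩
  · refine (hperm.map Prod.snd).trans ?_
    rw [hkeys, List.map_map]
    exact (List.map_id _).symm ▸ List.Perm.refl _
  · rw [List.pairwise_map]
    refine (sort_sorted keys).imp_of_mem ?_
    intro p q hp hq h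
    have key : ∀ p ∈ (sort keys).val, p.1 = |(V *ᵥ c) p.2| := by
      intro p hp
      obtain ⟨i, -, rfl⟩ := List.mem_map.1 (hperm.mem_iff.1 hp)
      rfl
    rwa [← key p hp, ← key q hq]
  · have hM : (fun i l => V (t 0) l - b i * V (t i.succ) l) = tieMatrix V t b := rfl
    have hV : (fun i => (|∑ l, V i l * c l|, i)) = fun i => (|(V *ᵥ c) i|, i) := rfl
    rw [← countIn_val]
    simp only [spannogramBody, bind_val, array_val, step_val, indices_val, map_val, sumLoop_val,
      take_val, toList_val, hM, ← hc, hV, ← hkeys, apply_ite_val, append_val,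
      decide_eq_true_eq]
    rfl

/-! ### Running time -/

namespace Timed

theorem array_cost_le {α : Type} {m : ℕ} (f : Fin m → Timed α) (K : ℕ)
    (h : ∀ i, (f i).cost ≤ K) : (array f).cost ≤ 1 + m * (K + 1) := by
  rw [array_cost]
  refine Nat.add_le_add_left ((Finset.sum_le_card_nsmul _ _ (K + 1) fun i _ => ?_).trans ?_) _
  · exact Nat.add_le_add_right (h i) 1
  · simp

theorem sumLoop_cost_le {m : ℕ} (f : Fin m → Timed ℝ) (K : ℕ)
    (h : ∀ i, (f i).cost ≤ K) : (sumLoop f).cost ≤ 1 + m * (K + 2) := by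
  rw [sumLoop_cost]
  refine Nat.add_le_add_left ((Finset.sum_le_card_nsmul _ _ (K + 2) fun i _ => ?_).trans ?_) _
  · exact Nat.add_le_add_right (h i) 2
  · simp

theorem length_cost {α : Type} (l : List α) : (length l).cost = l.length + 1 := by
  induction l with
  | nil => rfl
  | cons x l ih => simp [length, ih]

theorem append_cost {α : Type} (l l' : List α) : (append l l').cost = l.length + 1 := by
  induction l with
  | nil => rfl
  | cons x l ih => simp [append, ih]

theorem map_cost_le {α β : Type} (f : α → Timed β) (l : List α) (K : ℕ)
    (h : ∀ x, (f x).cost ≤ K) : (map f l).cost ≤ l.length * (K + 1) + 1 := by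
  induction l with
  | nil => simp [map]
  | cons x l ih =>
    have := h x
    simp only [map, bind_cost, step_cost, List.length_cons, add_mul]
    omega

theorem flatMap_cost_le {α β : Type} (f : α → Timed (List β)) (l : List α) (K B : ℕ)
    (h : ∀ x, (f x).cost ≤ K) (hB : ∀ x, (f x).val.length ≤ B) :
    (flatMap f l).cost ≤ l.length * (K + B + 2) + 1 := by
  induction l with
  | nil => simp [flatMap]
  | cons x l ih =>
    have h1 := h x
    have h2 := hB x
    simp only [flatMap, bind_cost, step_cost, append_cost, List.length_cons, Nat.succ_mul]
    omega

theorem flatMap_length_le {α β : Type} (f : α → List β) (l : List α) (B : ℕ)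
    (hB : ∀ x, (f x).length ≤ B) : (l.flatMap f).length ≤ l.length * B := by
  induction l with
  | nil => simp
  | cons x l ih =>
    have h2 := hB x
    simp only [List.flatMap_cons, List.length_append, List.length_cons, Nat.succ_mul]
    omega

theorem take_cost_le {α : Type} (k : ℕ) (l : List α) : (take k l).cost ≤ l.length + 1 := by
  induction k generalizing l with
  | zero => simp [take]
  | succ k ih =>
    cases l with
    | nil => simp [take]
    | cons x l => simpa [take] using ih l

theorem mem_cost_le {n : ℕ} (x : Fin n) (l : List (Fin n)) :
    (mem x l).cost ≤ 2 * l.length + 1 := by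
  induction l with
  | nil => simp [mem]
  | cons y l ih =>
    by_cases h : x = y
    · simp [mem, h]
      omega
    · simp [mem, h]
      omega

theorem countIn_cost_le {n : ℕ} (T l : List (Fin n)) :
    (countIn T l).cost ≤ l.length * (2 * T.length + 2) + 1 := by
  induction l with
  | nil => simp [countIn]
  | cons y l ih =>
    have := mem_cost_le y T
    generalize hE : 2 * T.length + 2 = E at *
    by_cases h : y ∈ T <;>
    · simp only [countIn, bind_cost, mem_val, h, decide_true, decide_false, if_true,
        Bool.false_eq_true, if_false, step_cost, List.length_cons, Nat.succ_mul]
      omega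

theorem merge_cost_le {n : ℕ} (l l' : List (ℝ × Fin n)) :
    (merge l l').cost ≤ 2 * (l.length + l'.length) + 1 := by
  fun_induction merge l l' with
  | case1 l' => simp
  | case2 x l => simp
  | case3 x l y l' ih1 ih2 =>
    by_cases h : y.1 ≤ x.1 <;> simp [h] at * <;> omega

theorem split_cost_le {α : Type} (l : List α) : (split l).cost ≤ l.length + 1 := by
  fun_induction split l with
  | case1 => simp
  | case2 x => simp
  | case3 x y l ih =>
    simp only [bind_cost, step_cost, List.length_cons]
    omega

/-- Splitting, merging and the final step cost at most 3 * length + 3 per call. The extra `+ 3` on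
the left absorbs the constant: each of the two recursive bounds contributes a 3, and one call needs
3 + 3. Each doubling of the length adds 3 to the factor. -/
theorem mergeSort_cost_le {n : ℕ} (p f : ℕ) (l : List (ℝ × Fin n)) (h0 : l ≠ [])
    (hp : l.length ≤ 2 ^ p) : (mergeSort f l).cost + 3 ≤ (3 * p + 4) * l.length := by
  induction p generalizing f l with
  | zero =>
    match l, h0, hp with
    | [x], _, _ => simp [mergeSort]
  | succ p ih =>
    match f, l, h0 with
    | 0, [x], _ => simp [mergeSort]
    | 0, x :: y :: l, _ => simp [mergeSort]; nlinarith
    | f + 1, [x], _ => simp [mergeSort]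
    | f + 1, x :: y :: l, _ =>
      obtain ⟨e1, e2⟩ := split_length (x :: y :: l)
      have hl : (x :: y :: l).length = l.length + 2 := rfl
      generalize hL : x :: y :: l = L at *
      have key : (mergeSort (f + 1) L).cost = (split L).cost +
          ((mergeSort f (split L).val.1).cost + ((mergeSort f (split L).val.2).cost +
          ((merge (mergeSort f (split L).val.1).val (mergeSort f (split L).val.2).val).cost
            + 1))) := by
        rw [← hL, mergeSort]
        · rfl
        all_goals simp
      have s := split_cost_le L
      have m := merge_cost_le (mergeSort f (split L).val.1).val (mergeSort f (split L).val.2).val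
      rw [(mergeSort_perm _ _).length_eq, (mergeSort_perm _ _).length_eq] at m
      have i1 := ih f (split L).val.1 (by rw [← List.length_pos_iff]; omega)
        (by rw [pow_succ] at hp; omega)
      have i2 := ih f (split L).val.2 (by rw [← List.length_pos_iff]; omega)
        (by rw [pow_succ] at hp; omega)
      have hsum : (split L).val.1.length + (split L).val.2.length = L.length := by omega
      rw [key, ← hsum]
      nlinarith

theorem sort_cost_le {n : ℕ} (p : ℕ) (l : List (ℝ × Fin n)) (h0 : l ≠ [])
    (hp : l.length ≤ 2 ^ p) : (sort l).cost ≤ l.length * (3 * p + 5) := by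
  have h := mergeSort_cost_le p (length l).val l h0 hp
  have : (sort l).cost = (length l).cost + (mergeSort (length l).val l).cost := rfl
  rw [this, length_cost]
  nlinarith

theorem signed_cost (j : ℕ) (x : ℝ) : (signed j x).cost = 2 := by
  rcases Nat.mod_two_eq_zero_or_one j with h | h <;> simp [signed, h]

/-- Expansion along a row takes a number of steps exponential in `m`, but `m` depends on d alone, so
a bound uniform in the entries is enough. -/
theorem exists_det_cost_le (m : ℕ) :
    ∃ C, ∀ M : Fin m → Fin m → ℝ, (det m M).cost ≤ C := by
  induction m with
  | zero => exact ⟨1, fun M => by simp [det]⟩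
  | succ m ih =>
    obtain ⟨C, hC⟩ := ih
    refine ⟨_, fun M => sumLoop_cost_le _ ((1 + m * ((1 + m * (2 + 1)) + 1)) + C + 4) fun j => ?_⟩
    simp only [bind_cost, step_cost, signed_cost]
    have h2 : (array fun i => array fun l => (do
        let q ← step (j.succAbove l)
        step (M (Fin.succ i) q) : Timed ℝ)).cost ≤ 1 + m * ((1 + m * (2 + 1)) + 1) :=
      array_cost_le _ _ fun i => array_cost_le _ _ fun l => le_rfl
    refine (Nat.add_le_add h2 (Nat.add_le_add_right (hC _) _)).trans ?_
    omega

theorem exists_nullVector_cost_le (m : ℕ) :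
    ∃ C, ∀ M : Fin m → Fin (m + 1) → ℝ, (nullVector M).cost ≤ C := by
  obtain ⟨C, hC⟩ := exists_det_cost_le m
  refine ⟨_, fun M => array_cost_le _ ((1 + m * ((1 + m * (2 + 1)) + 1)) + C + 2) fun j => ?_⟩
  simp only [bind_cost, signed_cost]
  have h2 : (array fun i => array fun l => (do
      let q ← step (j.succAbove l)
      step (M i q) : Timed ℝ)).cost ≤ 1 + m * ((1 + m * (2 + 1)) + 1) :=
    array_cost_le _ _ fun i => array_cost_le _ _ fun l => le_rfl
  refine (Nat.add_le_add h2 (Nat.add_le_add_right (hC _) _)).trans ?_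
  omega

theorem consArray_cost {α : Type} {m : ℕ} (x : α) (t : Fin m → α) :
    (consArray x t).cost = 2 * m + 3 := by
  simp [consArray, array_cost]
  omega

/-- The powers satisfy the Pascal-type inequality `h3`. The gap between (m + 8)² and (m + 9)² is 2m
+ 17, which covers the 2m + 5 steps per copied sequence and 3 further steps. -/
theorem choose_cost_le {α : Type} (m : ℕ) (l : List α) :
    (choose m l).cost ≤ (m + 8) ^ 2 * (l.length + 1) ^ m := by
  fun_induction choose m l with
  | case1 => simp
  | case2 m =>
    simp only [step_cost, List.length_nil, zero_add, one_pow, mul_one]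
    exact Nat.one_le_pow _ _ (by omega)
  | case3 m x l ih1 ih2 =>
    have hm := map_cost_le (consArray x) (choose m l).val (2 * m + 3) fun t =>
      (consArray_cost x t).le
    have hc : (choose m l).val.length ≤ (l.length + 1) ^ m := by
      rw [choose_length]
      exact (Nat.choose_le_pow _ _).trans (Nat.pow_le_pow_left (Nat.le_succ _) _)
    simp only [bind_cost, step_cost, append_cost, map_val, List.length_map, List.length_cons]
    have h1 : 1 ≤ (l.length + 1) ^ m := Nat.one_le_pow _ _ (Nat.succ_pos _)
    have h2 : (l.length + 1) ^ m ≤ (l.length + 1 + 1) ^ m :=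
      Nat.pow_le_pow_left (Nat.le_succ _) _
    have h3 : (l.length + 1) ^ (m + 1) + (l.length + 1) ^ m ≤ (l.length + 1 + 1) ^ (m + 1) := by
      rw [pow_succ, pow_succ]
      nlinarith
    have h4 : (choose m l).val.length * (2 * m + 3 + 1) ≤ (l.length + 1) ^ m * (2 * m + 4) :=
      Nat.mul_le_mul_right _ hc
    refine le_trans ?_ (Nat.mul_le_mul_left _ h3)
    generalize (l.length + 1) ^ m = P at *
    nlinarith

end Timed

theorem candidateLists_length_le {n m : ℕ} (t : Fin (m + 1) → Fin n) (k : ℕ)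
    (L : List (Fin n)) (r : ℕ) : (candidateLists t k L r).length ≤ 2 ^ (m + 1) + 1 := by
  unfold candidateLists
  split_ifs
  · simp only [List.length_cons, List.length_map, Timed.choose_length, List.length_ofFn]
    exact Nat.add_le_add_right (Nat.choose_le_two_pow _ _) 1
  · simp

-- Here `p` stands for a binary logarithm of `n`, so the bound is of order n log n, and `K` depends
-- on d alone.
open Timed in
theorem exists_spannogramBody_cost_le (m : ℕ) :
    ∃ K : ℕ, ∀ (n p k : ℕ) (V : Matrix (Fin n) (Fin (m + 1)) ℝ) (t : Fin (m + 1) → Fin n)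
      (b : Fin m → ℝ), n ≤ 2 ^ p → (spannogramBody V k t b).cost ≤ K * (n * (p + 1)) := by
  obtain ⟨C, hC⟩ := exists_nullVector_cost_le m
  -- One summand for each stage of the body, in order of execution; each stage costs at most its
  -- summand times n(p + 1).
  refine ⟨(1 + m * (1 + (m + 1) * 5 + 1)) + C + 2 + (1 + (m + 1) * 5 + 4) + 5 + 3 + 2 + (m + 2)
    + (2 * (m + 1) + 3) + 1 + 1 + 2 + (m + 9) ^ 2 * (m + 2) ^ (m + 1)
    + (2 ^ (m + 1) * (m + 5) + 1) + 1, fun n p k V t b hp => ?_⟩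
  have hn : 0 < n := (Nat.zero_le _).trans_lt (t 0).2
  unfold spannogramBody
  simp only [bind_cost]
  generalize hM : (array fun j : Fin m => array fun l => (do
      let x ← step (V (t 0) l)
      let y ← step (V (t j.succ) l)
      let z ← step (b j * y)
      step (x - z) : Timed ℝ)) = M
  have c1 : M.cost ≤ 1 + m * (1 + (m + 1) * 5 + 1) := by
    rw [← hM]
    exact array_cost_le _ _ fun j => array_cost_le _ _ fun l => le_rfl
  have c2 := hC M.val
  generalize nullVector M.val = c at *
  generalize hkeys : map (fun i => (do
      let x ← sumLoop fun l => (do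
        let y ← step (V i l)
        let z ← step (c.val l)
        step (y * z) : Timed ℝ)
      let a ← step |x|
      step (a, i) : Timed (ℝ × Fin n))) (indices n).val = keys
  have c3 : keys.cost ≤ n * (1 + (m + 1) * 5 + 2 + 1) + 1 := by
    rw [← hkeys]
    refine (map_cost_le _ _ (1 + (m + 1) * 5 + 2) fun i => ?_).trans ?_
    · simp only [bind_cost, step_cost]
      exact Nat.add_le_add_right (sumLoop_cost_le _ 3 fun l => le_rfl) 2
    · simp
  have hlen : keys.val.length = n := by rw [← hkeys]; simp
  have c4 := sort_cost_le p keys.val (by rw [← List.length_pos_iff]; omega)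
    (by rw [hlen]; exact hp)
  have hlen2 : (sort keys.val).val.length = n := by rw [(sort_perm _).length_eq, hlen]
  rw [hlen] at c4
  generalize sort keys.val = sorted at *
  have c5 := map_cost_le (fun p : ℝ × Fin n => step p.2) sorted.val 1 fun _ => le_rfl
  rw [hlen2] at c5
  have hlen3 : (map (fun p : ℝ × Fin n => step p.2) sorted.val).val.length = n := by simp [hlen2]
  generalize map (fun p : ℝ × Fin n => step p.2) sorted.val = I at *
  have c6 := take_cost_le k I.val
  rw [hlen3] at c6
  have hlen4 : (take k I.val).val.length ≤ n := by simp [hlen3]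
  generalize take k I.val = J at *
  have ht1 : (toList t).val.length = m + 1 := by simp
  have ht2 : (toList t).cost = m + 1 + 1 := toList_cost t
  generalize toList t = T at *
  have c7 := countIn_cost_le T.val J.val
  have c7' : J.val.length * (2 * (m + 1) + 2) ≤ n * (2 * (m + 1) + 2) :=
    Nat.mul_le_mul_right _ hlen4
  rw [ht1] at c7
  generalize countIn T.val J.val = r at *
  simp only [ht2, indices_cost, step_cost, step_val]
  have hΛ : n ≤ n * (p + 1) := Nat.le_mul_of_pos_right _ (Nat.succ_pos _)
  have hΛ1 : 1 ≤ n * (p + 1) := hn.trans_le hΛ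
  have c8 : ∀ x : Timed (List (List (Fin n))), (x = if decide (r.val < m + 1) = true then do
      let q ← step (k - r.val)
      let top ← take q I.val
      let Ms ← choose r.val T.val
      let Js ← map (fun M => do
        let L ← toList M
        append top L) Ms
      step (J.val :: Js)
      else step [J.val]) → x.cost ≤
      (1 + 2 + (m + 9) ^ 2 * (m + 2) ^ (m + 1) + (2 ^ (m + 1) * (m + 5) + 1) + 1) *
        (n * (p + 1)) := by
    rintro x rfl
    by_cases hr : r.val < m + 1
    · simp only [hr, decide_true, if_true, bind_cost, step_cost, step_val]
      have d1 := take_cost_le (k - r.val) I.val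
      rw [hlen3] at d1
      have d2 := choose_cost_le r.val T.val
      rw [ht1] at d2
      have d2' : (r.val + 8) ^ 2 * (m + 1 + 1) ^ r.val ≤ (m + 9) ^ 2 * (m + 2) ^ (m + 1) :=
        Nat.mul_le_mul (Nat.pow_le_pow_left (by omega) _)
          (Nat.pow_le_pow_right (by omega) hr.le)
      have d3 := map_cost_le (fun M => (do
        let L ← toList M
        append (take (k - r.val) I.val).val L : Timed (List (Fin n))))
        (choose r.val T.val).val (m + n + 3) (fun M => by
          simp only [bind_cost, toList_cost, append_cost, take_val, List.length_take]
          have := min_le_right (k - r.val) I.val.length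
          omega)
      have d4 : (choose r.val T.val).val.length ≤ 2 ^ (m + 1) := by
        rw [choose_length, ht1]
        exact Nat.choose_le_two_pow _ _
      have d5 : (choose r.val T.val).val.length * (m + n + 3 + 1) ≤
          2 ^ (m + 1) * ((m + 5) * (n * (p + 1))) := by
        refine Nat.mul_le_mul d4 ?_
        nlinarith
      have d6 : (m + 9) ^ 2 * (m + 2) ^ (m + 1) ≤
          (m + 9) ^ 2 * (m + 2) ^ (m + 1) * (n * (p + 1)) := Nat.le_mul_of_pos_right _ hΛ1
      generalize (m + 9) ^ 2 * (m + 2) ^ (m + 1) = Q at *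
      generalize n * (p + 1) = Λ at *
      generalize 2 ^ (m + 1) = R at *
      linarith
    · simp only [hr, decide_false, Bool.false_eq_true, if_false, step_cost]
      exact Nat.one_le_iff_ne_zero.2 (by positivity)
  have c8' := c8 _ rfl
  have e1 : 1 + m * (1 + (m + 1) * 5 + 1) ≤ (1 + m * (1 + (m + 1) * 5 + 1)) * (n * (p + 1)) :=
    Nat.le_mul_of_pos_right _ hΛ1
  have e2 : C ≤ C * (n * (p + 1)) := Nat.le_mul_of_pos_right _ hΛ1
  have e3 : n * (1 + (m + 1) * 5 + 2 + 1) ≤ (1 + (m + 1) * 5 + 2 + 1) * (n * (p + 1)) := by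
    rw [mul_comm]; exact Nat.mul_le_mul_left _ hΛ
  have e4 : n * (3 * p + 5) ≤ 5 * (n * (p + 1)) := by nlinarith
  have e5 : m + 2 ≤ (m + 2) * (n * (p + 1)) := Nat.le_mul_of_pos_right _ hΛ1
  have e6 : n * (2 * (m + 1) + 2) ≤ (2 * (m + 1) + 2) * (n * (p + 1)) := by
    rw [mul_comm]; exact Nat.mul_le_mul_left _ hΛ
  generalize (m + 9) ^ 2 * (m + 2) ^ (m + 1) = Q at *
  generalize 2 ^ (m + 1) = R at *
  generalize n * (p + 1) = Λ at *
  generalize 1 + m * (1 + (m + 1) * 5 + 1) = A at *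
  linarith

open Timed in
theorem exists_spannogramTime_le_nat (m : ℕ) :
    ∃ K : ℕ, ∀ (n p k : ℕ) (V : Matrix (Fin n) (Fin (m + 1)) ℝ), 1 ≤ n → n ≤ 2 ^ p →
      spannogramTime V k ≤ K * (n ^ (m + 1) * (n * (p + 1))) := by
  obtain ⟨K, hK⟩ := exists_spannogramBody_cost_le m
  set B := 2 ^ (m + 1) + 1 with hB
  refine ⟨(2 ^ m * (K + B + 2) + 1 + 2 ^ m * B + 2) + (m + 9) ^ 2 * 2 ^ (m + 1) +
    (signs m).cost + 3, fun n p k V hn hp => ?_⟩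
  have hΛ : n ≤ n * (p + 1) := Nat.le_mul_of_pos_right _ (Nat.succ_pos _)
  have hΛ1 : 1 ≤ n * (p + 1) := hn.trans hΛ
  have hP : 1 ≤ n ^ (m + 1) := Nat.one_le_pow _ _ hn
  have len1 : ∀ t b, (spannogramBody V k t b).val.length ≤ B := fun t b => by
    obtain ⟨L, -, -, h⟩ := spannogramBody_val V k t b
    rw [h]
    exact candidateLists_length_le t k L _
  have c1 : ∀ t, (flatMap (fun b => spannogramBody V k t b) (signs m).val).cost ≤
      2 ^ m * (K * (n * (p + 1)) + B + 2) + 1 := fun t => by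
    have := flatMap_cost_le (fun b => spannogramBody V k t b) (signs m).val _ B
      (fun b => hK n p k V t b hp) (len1 t)
    rwa [signs_length] at this
  have len2 : ∀ t, (flatMap (fun b => spannogramBody V k t b) (signs m).val).val.length ≤
      2 ^ m * B := fun t => by
    rw [flatMap_val]
    refine (flatMap_length_le _ _ B (len1 t)).trans_eq ?_
    rw [signs_length]
  have c2 := flatMap_cost_le _ (choose (m + 1) (List.finRange n)).val _ _ c1 len2
  have c3 := choose_cost_le (m + 1) (List.finRange n)
  rw [List.length_finRange] at c3
  have c3' : (m + 1 + 8) ^ 2 * (n + 1) ^ (m + 1) ≤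
      (m + 9) ^ 2 * (2 ^ (m + 1) * n ^ (m + 1)) := by
    rw [← mul_pow]
    exact Nat.mul_le_mul_left _ (Nat.pow_le_pow_left (by omega) _)
  rw [choose_length, List.length_finRange] at c2
  have c4 := Nat.choose_le_pow n (m + 1)
  have hcost : spannogramTime V k = (n + 1) + ((choose (m + 1) (List.finRange n)).cost +
    ((signs m).cost + (flatMap (fun t => flatMap (fun b => spannogramBody V k t b)
      (signs m).val) (choose (m + 1) (List.finRange n)).val).cost)) := rfl
  rw [hcost]
  have c5 : 2 ^ m * (K * (n * (p + 1)) + B + 2) + 1 + 2 ^ m * B + 2 ≤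
      (2 ^ m * (K + B + 2) + 1 + 2 ^ m * B + 2) * (n * (p + 1)) := by
    generalize n * (p + 1) = Λ at *
    have : 2 ^ m * B ≤ 2 ^ m * B * Λ := Nat.le_mul_of_pos_right _ hΛ1
    have : 2 ^ m ≤ 2 ^ m * Λ := Nat.le_mul_of_pos_right _ hΛ1
    nlinarith
  have c6 := Nat.mul_le_mul c4 c5
  generalize 2 ^ m * (K + B + 2) + 1 + 2 ^ m * B + 2 = X at *
  have f1 : n * (p + 1) ≤ n ^ (m + 1) * (n * (p + 1)) := Nat.le_mul_of_pos_left _ hP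
  have f2 : n ^ (m + 1) ≤ n ^ (m + 1) * (n * (p + 1)) := Nat.le_mul_of_pos_right _ hΛ1
  have f3 : (signs m).cost ≤ (signs m).cost * (n ^ (m + 1) * (n * (p + 1))) :=
    Nat.le_mul_of_pos_right _ (hΛ1.trans f1)
  have f4 := Nat.mul_le_mul_left ((m + 9) ^ 2 * 2 ^ (m + 1)) f2
  generalize n * (p + 1) = Λ at *
  generalize n ^ (m + 1) = P at *
  generalize 2 ^ (m + 1) = R at *
  nlinarith

theorem exists_spannogramTime_le (d : ℕ) (hd : 1 ≤ d) :
    ∃ C : ℝ, ∀ (n k : ℕ) (V : Matrix (Fin n) (Fin d) ℝ), 2 ≤ n →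
      (spannogramTime V k : ℝ) ≤ C * (n : ℝ) ^ (d + 1) * Real.log n := by
  obtain ⟨m, rfl⟩ : ∃ m, d = m + 1 := ⟨d - 1, by omega⟩
  obtain ⟨K, hK⟩ := exists_spannogramTime_le_nat m
  -- With p = ⌊log₂ n⌋ + 1 the factor p + 1 is at most log₂ n + 2, hence at most 3 log₂ n because `n
  -- ≥ 2`.
  refine ⟨K * (3 / Real.log 2), fun n k V hn => ?_⟩
  have h := hK n (Nat.log 2 n + 1) k V (by omega) (Nat.lt_pow_succ_log_self (by norm_num) n).le
  have h' : (spannogramTime V k : ℝ) ≤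
      K * ((n : ℝ) ^ (m + 1) * (n * (((Nat.log 2 n + 1 : ℕ) : ℝ) + 1))) := by exact_mod_cast h
  refine h'.trans ?_
  have hl2 : 0 < Real.log 2 := Real.log_pos (by norm_num)
  have hlog : (Nat.log 2 n : ℝ) ≤ Real.log n / Real.log 2 := Real.natLog_le_logb n 2
  have h1 : 1 ≤ Real.log n / Real.log 2 := by
    rw [le_div_iff₀ hl2, one_mul]
    exact Real.log_le_log (by norm_num) (by exact_mod_cast hn)
  have h2 : (((Nat.log 2 n + 1 : ℕ) : ℝ) + 1) ≤ 3 / Real.log 2 * Real.log n := by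
    push_cast
    rw [div_mul_eq_mul_div, mul_div_assoc]
    linarith
  calc (K : ℝ) * ((n : ℝ) ^ (m + 1) * (n * (((Nat.log 2 n + 1 : ℕ) : ℝ) + 1)))
      ≤ K * ((n : ℝ) ^ (m + 1) * (n * (3 / Real.log 2 * Real.log n))) := by gcongr
    _ = _ := by ring

/-! ### Moving to a vector with `d` ties at the threshold -/

theorem mulVec_ne_zero_of_rank_eq {n d : ℕ} {V : Matrix (Fin n) (Fin d) ℝ} (hV : V.rank = d)
    {c : Fin d → ℝ} (hc : c ≠ 0) : V *ᵥ c ≠ 0 := by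
  intro h
  have h1 := LinearMap.finrank_range_add_finrank_ker V.mulVecLin
  have h2 : Module.finrank ℝ (LinearMap.range V.mulVecLin) = d := hV
  rw [h2, Module.finrank_fin_fun] at h1
  have h3 : LinearMap.ker V.mulVecLin = ⊥ := Submodule.finrank_eq_zero.1 (by omega)
  exact hc (LinearMap.ker_eq_bot'.1 h3 c h)

theorem InGeneralPosition.card_le {n d : ℕ} {V : Matrix (Fin n) (Fin d) ℝ}
    (hG : InGeneralPosition V) {c : Fin d → ℝ} (hc : c ≠ 0) (S : Finset (Fin n)) (v : ℝ)
    (hS : ∀ i ∈ S, |(V *ᵥ c) i| = v) : S.card ≤ d := by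
  by_contra! h
  obtain ⟨S', hS', hcard⟩ := Finset.exists_subset_card_eq (Nat.succ_le_of_lt h)
  refine hG (S'.orderEmbOfFin hcard) (S'.orderEmbOfFin hcard).injective c hc fun i => ?_
  rw [hS _ (hS' (S'.orderEmbOfFin_mem hcard i)), hS _ (hS' (S'.orderEmbOfFin_mem hcard 0))]

/-- `v` separates the absolute values of the entries of `w` in `I` from those outside `I`. -/
def IsThreshold {n : ℕ} (w : Fin n → ℝ) (I : Finset (Fin n)) (v : ℝ) : Prop :=
  (∀ i ∈ I, v ≤ |w i|) ∧ ∀ j ∉ I, |w j| ≤ v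

/-- Along the line c + s u the entries already at level 1 stand still. The feasible parameters s
form a closed set that contains 0 and is not the whole line; at a frontier point of it a new entry
must have reached the level. -/
theorem exists_threshold_add_active {n d : ℕ} (V : Matrix (Fin n) (Fin d) ℝ) (I : Finset (Fin n))
    (c u : Fin d → ℝ) (hc : IsThreshold (V *ᵥ c) I 1)
    (hu : ∀ i, |(V *ᵥ c) i| = 1 → (V *ᵥ u) i = 0) (hVu : V *ᵥ u ≠ 0) :
    ∃ c', IsThreshold (V *ᵥ c') I 1 ∧ (∀ i, |(V *ᵥ c) i| = 1 → |(V *ᵥ c') i| = 1) ∧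
      ∃ i, |(V *ᵥ c) i| ≠ 1 ∧ |(V *ᵥ c') i| = 1 := by
  set x := V *ᵥ c with hx
  set a := V *ᵥ u with ha
  have hval : ∀ (s : ℝ) i, (V *ᵥ (c + s • u)) i = x i + s * a i := fun s i => by
    rw [Matrix.mulVec_add, Matrix.mulVec_smul]; rfl
  set F : Set ℝ := {s | ∀ i, (i ∈ I → 1 ≤ |x i + s * a i|) ∧ (i ∉ I → |x i + s * a i| ≤ 1)} with hF
  have hclosed : IsClosed F := by
    have : F = ⋂ i, ({s | i ∈ I → 1 ≤ |x i + s * a i|} ∩ {s | i ∉ I → |x i + s * a i| ≤ 1}) := by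
      ext s; simp [hF]
    rw [this]
    refine isClosed_iInter fun i => IsClosed.inter ?_ ?_
    · by_cases hi : i ∈ I
      · simp only [hi, forall_const]
        exact isClosed_le continuous_const (by fun_prop)
      · simp [hi]
    · by_cases hi : i ∈ I
      · simp [hi]
      · simp only [hi, not_false_eq_true, forall_const]
        exact isClosed_le (by fun_prop) continuous_const
  have h0 : (0 : ℝ) ∈ F := fun i => by
    simpa using ⟨hc.1 i, hc.2 i⟩
  have hne : F ≠ Set.univ := by
    obtain ⟨i, hi⟩ := Function.ne_iff.1 hVu
    have hi' : a i ≠ 0 := hi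
    intro hFu
    -- Since `a i ≠ 0`, the entry at `i` takes every value along the line: 0 is forbidden inside
    -- `I`, and 2 is forbidden outside.
    by_cases hI : i ∈ I
    · have h := ((hFu ▸ Set.mem_univ (-x i / a i) : -x i / a i ∈ F) i).1 hI
      rw [div_mul_cancel₀ _ hi'] at h
      norm_num at h
    · have h := ((hFu ▸ Set.mem_univ ((2 - x i) / a i) : (2 - x i) / a i ∈ F) i).2 hI
      rw [div_mul_cancel₀ _ hi'] at h
      norm_num at h
  obtain ⟨s, hs⟩ := nonempty_frontier_iff.2 ⟨⟨0, h0⟩, hne⟩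
  rw [hclosed.frontier_eq] at hs
  obtain ⟨hsF, hsi⟩ := hs
  refine ⟨c + s • u, ⟨fun i hi => ?_, fun i hi => ?_⟩, fun i hi => ?_, ?_⟩
  · rw [hval]; exact (hsF i).1 hi
  · rw [hval]; exact (hsF i).2 hi
  · rw [hval, hu i hi, mul_zero, add_zero, hi]
  · by_contra! hno
    refine hsi (mem_interior_iff_mem_nhds.2 ?_)
    -- Without a new active entry, every constraint is either constant in s' or strict at `s`, so
    -- `s` would be an interior point.
    have hall : ∀ᶠ s' in nhds s, ∀ i, (i ∈ I → 1 ≤ |x i + s' * a i|) ∧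
        (i ∉ I → |x i + s' * a i| ≤ 1) := by
      refine Filter.eventually_all.2 fun i => ?_
      by_cases hi : |x i| = 1
      · exact Filter.Eventually.of_forall fun s' => by simp [hu i hi, hi]
      · have hno' : |x i + s * a i| ≠ 1 := by rw [← hval]; exact hno i hi
        have hcont : Continuous fun s' : ℝ => |x i + s' * a i| := by fun_prop
        by_cases hI : i ∈ I
        · have := lt_of_le_of_ne ((hsF i).1 hI) hno'.symm
          filter_upwards [hcont.continuousAt.eventually (lt_mem_nhds this)] with s' hs'
          exact ⟨fun _ => hs'.le, fun h => absurd hI h⟩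
        · have := lt_of_le_of_ne ((hsF i).2 hI) hno'
          filter_upwards [hcont.continuousAt.eventually (gt_mem_nhds this)] with s' hs'
          exact ⟨fun h => absurd h hI, fun _ => hs'.le⟩
    exact hall

/-- Induction on the number of entries off the level: fewer than `d` rows of V have a common nonzero
kernel vector, which serves as direction of travel. -/
theorem exists_vertex {n d : ℕ} {V : Matrix (Fin n) (Fin d) ℝ} (hV : V.rank = d)
    (I : Finset (Fin n)) (c : Fin d → ℝ) (hc : IsThreshold (V *ᵥ c) I 1) :
    ∃ c', IsThreshold (V *ᵥ c') I 1 ∧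
      d ≤ (Finset.univ.filter fun i => |(V *ᵥ c') i| = 1).card := by
  induction hN : n - (Finset.univ.filter fun i => |(V *ᵥ c) i| = 1).card
    using Nat.strong_induction_on generalizing c with
  | _ N ih =>
    by_cases hcard : d ≤ (Finset.univ.filter fun i => |(V *ᵥ c) i| = 1).card
    · exact ⟨c, hc, hcard⟩
    · set S := Finset.univ.filter fun i => |(V *ᵥ c) i| = 1 with hS
      have hker := LinearMap.ker_ne_bot_of_finrank_lt
        (f := (V.submatrix (fun i : S => (i : Fin n)) id).mulVecLin) (by simpa using hcard)
      obtain ⟨u, hu, hu0⟩ := Submodule.exists_mem_ne_zero_of_ne_bot hker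
      obtain ⟨c', h1, h2, i, h3, h4⟩ := exists_threshold_add_active V I c u hc
        (fun i hi => congrFun (LinearMap.mem_ker.1 hu) ⟨i, by simp [hS, hi]⟩)
        (mulVec_ne_zero_of_rank_eq hV hu0)
      have hlt : S.card < (Finset.univ.filter fun i => |(V *ᵥ c') i| = 1).card := by
        refine Finset.card_lt_card (Finset.ssubset_iff_of_subset (fun j hj => ?_) |>.2
          ⟨i, by simp [h4], by simp [hS, h3]⟩)
        simp only [hS, Finset.mem_filter, Finset.mem_univ, true_and] at hj ⊢
        exact h2 j hj
      have hle := Finset.card_le_univ (Finset.univ.filter fun i => |(V *ᵥ c') i| = 1)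
      rw [Fintype.card_fin] at hle
      exact ih _ (by omega) c' h1 rfl

/-- Dividing by the smallest absolute value on `I`, which is nonzero by `hne`, turns 1 into a
threshold. -/
theorem exists_tie_of_ne_zero {n d k : ℕ} (hd : 1 ≤ d) (hk : 1 ≤ k)
    {V : Matrix (Fin n) (Fin d) ℝ} (hV : V.rank = d) {I : Finset (Fin n)} {c : Fin d → ℝ}
    (hI : IsTopK k (V *ᵥ c) I) (hne : ∀ i ∈ I, (V *ᵥ c) i ≠ 0) :
    ∃ c' ≠ 0, ∃ S : Finset (Fin n), S.card = d ∧ ∃ v, (∀ i ∈ S, |(V *ᵥ c') i| = v) ∧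
      IsThreshold (V *ᵥ c') I v := by
  obtain ⟨i₀, hi₀, hmin⟩ := I.exists_min_image (fun i => |(V *ᵥ c) i|)
    (Finset.card_pos.1 (by rw [hI.1]; omega))
  have hpos : 0 < |(V *ᵥ c) i₀| := abs_pos.2 (hne i₀ hi₀)
  have hval : ∀ i, |(V *ᵥ (|(V *ᵥ c) i₀|⁻¹ • c)) i| = |(V *ᵥ c) i| / |(V *ᵥ c) i₀| := fun i => by
    rw [Matrix.mulVec_smul, Pi.smul_apply, smul_eq_mul, abs_mul, abs_inv, abs_abs,
      inv_mul_eq_div]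
  obtain ⟨c', h1, h2⟩ := exists_vertex hV I (|(V *ᵥ c) i₀|⁻¹ • c)
    ⟨fun i hi => by rw [hval, one_le_div hpos]; exact hmin i hi,
      fun j hj => by rw [hval, div_le_one hpos]; exact hI.2 i₀ hi₀ j hj⟩
  obtain ⟨S, hS, hcard⟩ := Finset.exists_subset_card_eq h2
  have hS1 : ∀ i ∈ S, |(V *ᵥ c') i| = 1 := fun i hi => (Finset.mem_filter.1 (hS hi)).2
  refine ⟨c', ?_, S, hcard, 1, hS1, h1⟩
  rintro rfl
  obtain ⟨i, hi⟩ := Finset.card_pos.1 (show 0 < S.card by omega)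
  simpa using hS1 i hi

/-- Every set of `k` largest entries is also one of a vector `V c'` with `d` entries of the same
absolute value at the boundary of the set. -/
theorem exists_tie {n d k : ℕ} (hd : 1 ≤ d) (hk : 1 ≤ k)
    {V : Matrix (Fin n) (Fin d) ℝ} (hV : V.rank = d) (hG : InGeneralPosition V)
    {I : Finset (Fin n)} {c : Fin d → ℝ} (hc : c ≠ 0) (hI : IsTopK k (V *ᵥ c) I) :
    ∃ c' ≠ 0, ∃ S : Finset (Fin n), S.card = d ∧ ∃ v, (∀ i ∈ S, |(V *ᵥ c') i| = v) ∧
      IsThreshold (V *ᵥ c') I v := by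
  by_cases hne : ∀ i ∈ I, (V *ᵥ c) i ≠ 0
  · exact exists_tie_of_ne_zero hd hk hV hI hne
  push Not at hne
  obtain ⟨i₀, hi₀, hzero⟩ := hne
  -- A zero entry inside `I` forces all entries outside `I` to vanish.
  have hout : ∀ j ∉ I, (V *ᵥ c) j = 0 := fun j hj => by
    have := hI.2 i₀ hi₀ j hj
    rw [hzero, abs_zero] at this
    exact abs_nonpos_iff.1 this
  have hdn : d ≤ n := hV ▸ V.rank_le_height
  -- General position bounds the zero set by `d` elements, so it can be padded to exactly `d`.
  obtain ⟨Z, hZ, hZd⟩ := Finset.exists_superset_card_eq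
    (hG.card_le hc (Finset.univ.filter fun i => (V *ᵥ c) i = 0) 0 (by simp))
    (by simpa using hdn)
  have hZ' : ∀ i, (V *ᵥ c) i = 0 → i ∈ Z := fun i hi => hZ (by simp [hi])
  set e := Z.orderEmbOfFin hZd with he
  have hmem : ∀ i ∈ Z, ∃ j, e j = i := fun i hi => by
    have : i ∈ Set.range e := by rw [he, Finset.range_orderEmbOfFin]; exact hi
    exact this
  -- If the rows in `Z` are dependent, some nonzero vector makes all of `Z` vanish: a `d`-fold tie
  -- at level 0, which is a threshold because everything outside `I` lies in `Z`. Otherwise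
  -- prescribe the indicator of `I` on `Z` and perturb `c` slightly in that direction: the entries
  -- in `I` become nonzero and those outside stay 0.
  by_cases hdet : (V.submatrix e id).det = 0
  · obtain ⟨c', hc', h0⟩ := Matrix.exists_mulVec_eq_zero_iff.2 hdet
    have h0' : ∀ i ∈ Z, (V *ᵥ c') i = 0 := fun i hi => by
      obtain ⟨j, rfl⟩ := hmem i hi
      exact congrFun h0 j
    refine ⟨c', hc', Z, hZd, 0, fun i hi => by rw [h0' i hi, abs_zero],
      fun i _ => abs_nonneg _, fun j hj => ?_⟩
    rw [h0' j (hZ' j (hout j hj)), abs_zero]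
  · obtain ⟨u, hu⟩ := Matrix.mulVec_surjective_iff_isUnit.2
      ((Matrix.isUnit_iff_isUnit_det _).2 (isUnit_iff_ne_zero.2 hdet))
      (fun j => if e j ∈ I then (1 : ℝ) else 0)
    have hu' : ∀ i ∈ Z, (V *ᵥ u) i = if i ∈ I then (1 : ℝ) else 0 := fun i hi => by
      obtain ⟨j, rfl⟩ := hmem i hi
      exact congrFun hu j
    have hval : ∀ (s : ℝ) i, (V *ᵥ (c + s • u)) i = (V *ᵥ c) i + s * (V *ᵥ u) i := fun s i => by
      rw [Matrix.mulVec_add, Matrix.mulVec_smul]; rfl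
    have hev : ∀ᶠ s in nhdsWithin (0 : ℝ) (Set.Ioi 0), ∀ i, (V *ᵥ c) i ≠ 0 →
        (V *ᵥ c) i + s * (V *ᵥ u) i ≠ 0 := by
      refine nhdsWithin_le_nhds (Filter.eventually_all.2 fun i => ?_)
      by_cases hi : (V *ᵥ c) i = 0
      · simp [hi]
      · have hcont : Continuous fun s : ℝ => (V *ᵥ c) i + s * (V *ᵥ u) i := by fun_prop
        filter_upwards [(hcont.tendsto' 0 ((V *ᵥ c) i) (by simp)).eventually_ne hi]
          with s hs _ using hs
    obtain ⟨s, hs, hs0⟩ := (hev.and self_mem_nhdsWithin).exists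
    have hs0 : 0 < s := hs0
    refine exists_tie_of_ne_zero (c := c + s • u) hd hk hV ⟨hI.1, fun i _ j hj => ?_⟩
      fun i hi => ?_
    · rw [hval s j, hout j hj, hu' j (hZ' j (hout j hj)), if_neg hj]
      simp
    · rw [hval]
      by_cases h : (V *ᵥ c) i = 0
      · rw [h, hu' i (hZ' i h), if_pos hi]
        simpa using hs0.ne'
      · exact hs i h

/-! ### Null vectors of the tie systems -/

namespace Timed

/-- Laplace expansion along the added first row `a`; the signed minors are its cofactors. -/
theorem dotProduct_nullVector {m : ℕ} (M : Fin m → Fin (m + 1) → ℝ) (a : Fin (m + 1) → ℝ) :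
    a ⬝ᵥ (nullVector M).val = (Matrix.of (Fin.cons a M : Fin (m + 1) → Fin (m + 1) → ℝ)).det := by
  rw [Matrix.det_succ_row_zero]
  refine Finset.sum_congr rfl fun j _ => ?_
  rw [nullVector_val]
  simp only [Matrix.of_apply, Fin.cons_zero]
  have : (Matrix.of (Fin.cons a M : Fin (m + 1) → Fin (m + 1) → ℝ)).submatrix Fin.succ j.succAbove
      = (Matrix.of M).submatrix id j.succAbove := by
    ext i l; simp
  rw [this]
  ring

theorem row_dotProduct_nullVector {m : ℕ} (M : Fin m → Fin (m + 1) → ℝ) (i : Fin m) :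
    M i ⬝ᵥ (nullVector M).val = 0 := by
  rw [dotProduct_nullVector]
  exact Matrix.det_zero_of_row_eq (Fin.succ_ne_zero i).symm (by ext; simp)

/-- The hypothesis says that the square matrix with rows `a` and `M` is singular. When the null
vector is zero, `a` can be any extra equation. -/
theorem exists_ne_zero_of_dotProduct_nullVector {m : ℕ} (M : Fin m → Fin (m + 1) → ℝ)
    (a : Fin (m + 1) → ℝ) (h : a ⬝ᵥ (nullVector M).val = 0) :
    ∃ c ≠ 0, a ⬝ᵥ c = 0 ∧ ∀ i, M i ⬝ᵥ c = 0 := by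
  rw [dotProduct_nullVector] at h
  obtain ⟨c, hc, h0⟩ := Matrix.exists_mulVec_eq_zero_iff.2 h
  exact ⟨c, hc, congrFun h0 0, fun i => congrFun h0 i.succ⟩

/-- With z the null vector, the matrix with rows z and `M` has determinant z · z ≠ 0. It annihilates
(z · z) c - (z · c) z, which is therefore zero. -/
theorem eq_smul_nullVector {m : ℕ} {M : Fin m → Fin (m + 1) → ℝ} (hz : (nullVector M).val ≠ 0)
    {c : Fin (m + 1) → ℝ} (hc : ∀ i, M i ⬝ᵥ c = 0) : ∃ s : ℝ, c = s • (nullVector M).val := by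
  set z := (nullVector M).val with hzdef
  have hzz : z ⬝ᵥ z ≠ 0 := fun h => hz (dotProduct_self_eq_zero.1 h)
  have hdet := dotProduct_nullVector M z
  rw [← hzdef] at hdet
  have h0 : (z ⬝ᵥ z) • c - (z ⬝ᵥ c) • z = 0 := by
    by_contra hne
    refine hzz (hdet.trans (Matrix.exists_mulVec_eq_zero_iff.1 ⟨_, hne, ?_⟩))
    ext i
    refine Fin.cases ?_ (fun i => ?_) i
    · change z ⬝ᵥ ((z ⬝ᵥ z) • c - (z ⬝ᵥ c) • z) = 0
      rw [dotProduct_sub, dotProduct_smul, dotProduct_smul, smul_eq_mul, smul_eq_mul]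
      ring
    · change M i ⬝ᵥ ((z ⬝ᵥ z) • c - (z ⬝ᵥ c) • z) = 0
      rw [dotProduct_sub, dotProduct_smul, dotProduct_smul, hc, row_dotProduct_nullVector]
      simp
  refine ⟨(z ⬝ᵥ z)⁻¹ * (z ⬝ᵥ c), ?_⟩
  rw [mul_smul, ← sub_eq_zero.1 h0, smul_smul, inv_mul_cancel₀ hzz, one_smul]

end Timed

theorem tieMatrix_dotProduct {n m : ℕ} (V : Matrix (Fin n) (Fin (m + 1)) ℝ)
    (t : Fin (m + 1) → Fin n) (b : Fin m → ℝ) (c : Fin (m + 1) → ℝ) (j : Fin m) :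
    tieMatrix V t b j ⬝ᵥ c = (V *ᵥ c) (t 0) - b j * (V *ᵥ c) (t j.succ) := by
  have : tieMatrix V t b j = V (t 0) - b j • V (t j.succ) := rfl
  rw [this, sub_dotProduct, smul_dotProduct]
  rfl

theorem abs_eq_of_tie {n m : ℕ} {V : Matrix (Fin n) (Fin (m + 1)) ℝ}
    {t : Fin (m + 1) → Fin n} {b : Fin m → ℝ} (hb : ∀ j, b j = 1 ∨ b j = -1)
    {c : Fin (m + 1) → ℝ} (hc : ∀ j, tieMatrix V t b j ⬝ᵥ c = 0) (i : Fin (m + 1)) :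
    |(V *ᵥ c) (t i)| = |(V *ᵥ c) (t 0)| := by
  refine Fin.cases rfl (fun j => ?_) i
  have h := hc j
  rw [tieMatrix_dotProduct, sub_eq_zero] at h
  rw [h, abs_mul]
  rcases hb j with h | h <;> simp [h]

/-- If all minors vanished, one more linear equation could be imposed on a nonzero solution.
Equality with the entry at an index outside `t` gives `d + 1` ties, against general position. If `t`
exhausts the indices, the equation (Vc)_{t 0} = 0 gives Vc = 0, against the rank. -/
theorem nullVector_tieMatrix_ne_zero {n m : ℕ} {V : Matrix (Fin n) (Fin (m + 1)) ℝ}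
    (hV : V.rank = m + 1) (hG : InGeneralPosition V)
    {t : Fin (m + 1) → Fin n} (ht : Function.Injective t) {b : Fin m → ℝ}
    (hb : ∀ j, b j = 1 ∨ b j = -1) : (Timed.nullVector (tieMatrix V t b)).val ≠ 0 := by
  intro hz
  have key : ∀ a : Fin (m + 1) → ℝ, ∃ c ≠ 0, a ⬝ᵥ c = 0 ∧ ∀ i, tieMatrix V t b i ⬝ᵥ c = 0 :=
    fun a => Timed.exists_ne_zero_of_dotProduct_nullVector _ a (by rw [hz, dotProduct_zero])
  by_cases hsurj : Function.Surjective t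
  · obtain ⟨c, hc, h0, hM⟩ := key (V (t 0))
    refine mulVec_ne_zero_of_rank_eq hV hc (funext fun i => ?_)
    obtain ⟨j, rfl⟩ := hsurj i
    have h := abs_eq_of_tie hb hM j
    have h0' : (V *ᵥ c) (t 0) = 0 := h0
    rw [h0', abs_zero] at h
    exact abs_eq_zero.1 h
  · obtain ⟨i, hi⟩ := not_forall.1 hsurj
    obtain ⟨c, hc, h0, hM⟩ := key (V (t 0) - V i)
    rw [sub_dotProduct, sub_eq_zero] at h0
    have h0' : (V *ᵥ c) (t 0) = (V *ᵥ c) i := h0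
    refine hG (Fin.cons i t) (Fin.cons_injective_iff.2 ⟨fun ⟨j, hj⟩ => hi ⟨j, hj⟩, ht⟩) c hc ?_
    refine fun j => Fin.cases rfl (fun j => ?_) j
    simp only [Fin.cons_succ, Fin.cons_zero]
    rw [abs_eq_of_tie hb hM j, h0']

/-- A vector with `d` entries of the same absolute value is, up to scaling, one of those that the
algorithm computes. -/
theorem exists_signs_of_tie {n m : ℕ} {V : Matrix (Fin n) (Fin (m + 1)) ℝ}
    (hV : V.rank = m + 1) (hG : InGeneralPosition V)
    {t : Fin (m + 1) → Fin n} (ht : Function.Injective t) {c : Fin (m + 1) → ℝ} (hc : c ≠ 0)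
    (htie : ∀ i, |(V *ᵥ c) (t i)| = |(V *ᵥ c) (t 0)|) :
    ∃ b : Fin m → ℝ, (∀ j, b j = 1 ∨ b j = -1) ∧
      ∃ s : ℝ, s ≠ 0 ∧ c = s • (Timed.nullVector (tieMatrix V t b)).val := by
  have : ∀ j : Fin m, ∃ β : ℝ, (β = 1 ∨ β = -1) ∧ (V *ᵥ c) (t 0) = β * (V *ᵥ c) (t j.succ) :=
    fun j => by
      rcases abs_eq_abs.1 (htie j.succ) with h | h
      · exact ⟨1, Or.inl rfl, by rw [h, one_mul]⟩
      · exact ⟨-1, Or.inr rfl, by rw [h]; ring⟩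
  choose b hb hbt using this
  refine ⟨b, hb, ?_⟩
  obtain ⟨s, hs⟩ := Timed.eq_smul_nullVector (nullVector_tieMatrix_ne_zero hV hG ht hb)
    (c := c) fun j => by rw [tieMatrix_dotProduct, sub_eq_zero]; exact hbt j
  refine ⟨s, ?_, hs⟩
  rintro rfl
  exact hc (by rw [hs, zero_smul])

/-! ### Sets of largest entries around a level set -/

/-- An element of J outside U and one of U outside J contradict each other: the former is at least
as large, so upward closure would put it into U. Comparability then reduces inclusions to
cardinalities. -/
theorem IsTopK.subset_or_subset {n q : ℕ} {w : Fin n → ℝ} {J : Finset (Fin n)}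
    (hJ : IsTopK q w J) {U : Finset (Fin n)} (hU : ∀ i ∈ U, ∀ j, |w i| ≤ |w j| → j ∈ U) :
    J ⊆ U ∨ U ⊆ J := by
  by_contra! h
  obtain ⟨j, hj, hjU⟩ := Finset.not_subset.1 h.1
  obtain ⟨i, hi, hiJ⟩ := Finset.not_subset.1 h.2
  exact hjU (hU i hi j (hJ.2 j hj i hiJ))

theorem IsTopK.subset_of_le_card {n q : ℕ} {w : Fin n → ℝ} {J : Finset (Fin n)}
    (hJ : IsTopK q w J) {U : Finset (Fin n)} (hU : ∀ i ∈ U, ∀ j, |w i| ≤ |w j| → j ∈ U)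
    (h : q ≤ U.card) : J ⊆ U := by
  rcases hJ.subset_or_subset hU with h' | h'
  · exact h'
  · exact (Finset.eq_of_subset_of_card_le h' (hJ.1.trans_le h)).symm.subset

theorem IsTopK.superset_of_card_le {n q : ℕ} {w : Fin n → ℝ} {J : Finset (Fin n)}
    (hJ : IsTopK q w J) {U : Finset (Fin n)} (hU : ∀ i ∈ U, ∀ j, |w i| ≤ |w j| → j ∈ U)
    (h : U.card ≤ q) : U ⊆ J := by
  rcases hJ.subset_or_subset hU with h' | h'
  · exact (Finset.eq_of_subset_of_card_le h' (h.trans_eq hJ.1.symm)).symm.subset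
  · exact h'

theorem isTopK_take {n q : ℕ} {w : Fin n → ℝ} {L : List (Fin n)} (hL : L.Perm (List.finRange n))
    (hs : L.Pairwise fun i j => |w j| ≤ |w i|) (hq : q ≤ n) :
    IsTopK q w (L.take q).toFinset := by
  have hnd : L.Nodup := hL.nodup_iff.2 (List.nodup_finRange n)
  refine ⟨?_, fun i hi j hj => ?_⟩
  · rw [List.toFinset_card_of_nodup (hnd.sublist (List.take_sublist q L)), List.length_take,
      hL.length_eq, List.length_finRange, min_eq_left hq]
  · rw [← List.take_append_drop q L, List.pairwise_append] at hs
    rw [List.mem_toFinset] at hi hj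
    have hjL : j ∈ L := hL.mem_iff.2 (List.mem_finRange j)
    rw [← List.take_append_drop q L, List.mem_append] at hjL
    exact hs.2.2 i hi j (hjL.resolve_left hj)

/-- The indices of the entries of `w` of absolute value greater than `v`. -/
noncomputable def strictUpper {n : ℕ} (w : Fin n → ℝ) (v : ℝ) : Finset (Fin n) :=
  Finset.univ.filter fun i => v < |w i|

theorem strictUpper_isUpper {n : ℕ} {w : Fin n → ℝ} {v : ℝ} :
    ∀ i ∈ strictUpper w v, ∀ j, |w i| ≤ |w j| → j ∈ strictUpper w v := by
  simp only [strictUpper, Finset.mem_filter, Finset.mem_univ, true_and]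
  exact fun i hi j h => hi.trans_le h

section LevelSet

variable {n : ℕ} {w : Fin n → ℝ} {v : ℝ} {T : Finset (Fin n)}

theorem mem_strictUpper_union (hT : ∀ i, i ∈ T ↔ |w i| = v) {i : Fin n} :
    i ∈ strictUpper w v ∪ T ↔ v ≤ |w i| := by
  simp only [strictUpper, Finset.mem_union, Finset.mem_filter, Finset.mem_univ, true_and, hT]
  rw [le_iff_lt_or_eq, eq_comm]

theorem strictUpper_union_isUpper (hT : ∀ i, i ∈ T ↔ |w i| = v) :
    ∀ i ∈ strictUpper w v ∪ T, ∀ j, |w i| ≤ |w j| → j ∈ strictUpper w v ∪ T := by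
  simp only [mem_strictUpper_union hT]
  exact fun i hi j h => hi.trans h

theorem disjoint_strictUpper (hT : ∀ i, i ∈ T ↔ |w i| = v) : Disjoint (strictUpper w v) T := by
  refine Finset.disjoint_left.2 fun i hi hi' => ?_
  simp only [strictUpper, Finset.mem_filter, Finset.mem_univ, true_and] at hi
  exact hi.ne' ((hT i).1 hi')

theorem IsThreshold.strictUpper_subset {I : Finset (Fin n)} (hI : IsThreshold w I v) :
    strictUpper w v ⊆ I := fun i hi => by
  simp only [strictUpper, Finset.mem_filter, Finset.mem_univ, true_and] at hi
  by_contra h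
  exact (hI.2 i h).not_gt hi

theorem IsThreshold.subset_union {I : Finset (Fin n)} (hI : IsThreshold w I v)
    (hT : ∀ i, i ∈ T ↔ |w i| = v) : I ⊆ strictUpper w v ∪ T :=
  fun i hi => (mem_strictUpper_union hT).2 (hI.1 i hi)

theorem isTopK_strictUpper_union {k : ℕ} (hT : ∀ i, i ∈ T ↔ |w i| = v)
    (hk : (strictUpper w v).card ≤ k) {M : Finset (Fin n)} (hM : M ⊆ T)
    (hcard : M.card = k - (strictUpper w v).card) : IsTopK k w (strictUpper w v ∪ M) := by
  refine ⟨?_, fun i hi j hj => ?_⟩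
  · rw [Finset.card_union_of_disjoint (Finset.disjoint_of_subset_right hM
      (disjoint_strictUpper hT)), hcard]
    omega
  · have h1 := (mem_strictUpper_union hT).1 (Finset.union_subset_union_right hM hi)
    refine le_trans (not_lt.1 fun h => hj (Finset.mem_union_left _ ?_)) h1
    simpa [strictUpper] using h

variable {m k : ℕ} {t : Fin (m + 1) → Fin n} {L : List (Fin n)}

theorem countP_take_eq (hL : L.Nodup) :
    ((L.take k).countP fun x => decide (x ∈ List.ofFn t)) =
      ((L.take k).toFinset ∩ (List.ofFn t).toFinset).card := by
  rw [List.countP_eq_length_filter,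
    ← List.toFinset_card_of_nodup ((hL.sublist (List.take_sublist k L)).filter _)]
  congr 1
  ext x
  simp

/-- The cut falls strictly inside the level set T, with U the strictly larger indices. The sorted
prefix lies between U and U ∪ T, so r = k - |U|, and the first k - r = |U| indices are exactly U. -/
theorem exists_mem_candidateLists_iff_of_lt (ht : Function.Injective t)
    (hT : ∀ i, i ∈ (List.ofFn t).toFinset ↔ |w i| = v)
    (hL : L.Perm (List.finRange n)) (hs : L.Pairwise fun i j => |w j| ≤ |w i|) (hk : k ≤ n)
    (h1 : (strictUpper w v).card < k) (h2 : k < (strictUpper w v).card + (m + 1))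
    (S : Finset (Fin n)) :
    (∃ l ∈ candidateLists t k L ((L.take k).countP fun x => decide (x ∈ List.ofFn t)),
      l.toFinset = S) ↔ ∃ M ⊆ (List.ofFn t).toFinset,
        M.card = k - (strictUpper w v).card ∧ strictUpper w v ∪ M = S := by
  have hTcard : (List.ofFn t).toFinset.card = m + 1 := by
    rw [List.toFinset_card_of_nodup (List.nodup_ofFn.2 ht), List.length_ofFn]
  have hJ := isTopK_take hL hs hk
  have hJ1 := hJ.superset_of_card_le strictUpper_isUpper h1.le
  have hJ2 := hJ.subset_of_le_card (strictUpper_union_isUpper hT) (by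
    rw [Finset.card_union_of_disjoint (disjoint_strictUpper hT), hTcard]; exact h2.le)
  have hdis := disjoint_strictUpper hT
  rw [countP_take_eq (hL.nodup_iff.2 (List.nodup_finRange n))]
  have hsplit : strictUpper w v ∪ ((L.take k).toFinset ∩ (List.ofFn t).toFinset) =
      (L.take k).toFinset := by
    rw [Finset.union_inter_distrib_left, Finset.union_eq_right.2 hJ1, Finset.inter_eq_left.2 hJ2]
  have hr : ((L.take k).toFinset ∩ (List.ofFn t).toFinset).card =
      k - (strictUpper w v).card := by
    have := congrArg Finset.card hsplit
    rw [Finset.card_union_of_disjoint (Finset.disjoint_of_subset_right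
      Finset.inter_subset_right hdis), hJ.1] at this
    omega
  have htop : (L.take (k - (k - (strictUpper w v).card))).toFinset = strictUpper w v := by
    rw [Nat.sub_sub_self h1.le]
    have hq := isTopK_take (q := (strictUpper w v).card) hL hs (h1.le.trans hk)
    exact Finset.eq_of_subset_of_card_le (hq.subset_of_le_card strictUpper_isUpper le_rfl)
      hq.1.ge
  rw [candidateLists, hr, if_pos (by omega)]
  simp only [List.mem_cons, List.mem_map, exists_eq_or_imp]
  constructor
  · rintro (h | ⟨_, ⟨M, hM, rfl⟩, h⟩)
    · exact ⟨_, Finset.inter_subset_right, hr, hsplit.trans h⟩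
    · obtain ⟨h3, h4⟩ := (Timed.exists_mem_choose_iff (List.nodup_ofFn.2 ht) _).1 ⟨M, hM, rfl⟩
      refine ⟨_, h3, h4, ?_⟩
      rw [← h, List.toFinset_append, htop]
  · rintro ⟨M, hM, hcard, rfl⟩
    obtain ⟨M', hM', rfl⟩ := (Timed.exists_mem_choose_iff (List.nodup_ofFn.2 ht) M).2 ⟨hM, hcard⟩
    refine Or.inr ⟨_, ⟨M', hM', rfl⟩, ?_⟩
    rw [List.toFinset_append, htop]

/-- If k ≤ |U|, then r = 0 and the only added union repeats the prefix. Otherwise all of T is in the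
prefix, r = d, and no union is added. -/
theorem exists_mem_candidateLists_iff_of_not_lt (ht : Function.Injective t)
    (hT : ∀ i, i ∈ (List.ofFn t).toFinset ↔ |w i| = v)
    (hL : L.Perm (List.finRange n)) (hs : L.Pairwise fun i j => |w j| ≤ |w i|) (hk : k ≤ n)
    (h : ¬ ((strictUpper w v).card < k ∧ k < (strictUpper w v).card + (m + 1)))
    (S : Finset (Fin n)) :
    (∃ l ∈ candidateLists t k L ((L.take k).countP fun x => decide (x ∈ List.ofFn t)),
      l.toFinset = S) ↔ (L.take k).toFinset = S := by
  have hTcard : (List.ofFn t).toFinset.card = m + 1 := by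
    rw [List.toFinset_card_of_nodup (List.nodup_ofFn.2 ht), List.length_ofFn]
  have hJ := isTopK_take hL hs hk
  rw [countP_take_eq (hL.nodup_iff.2 (List.nodup_finRange n))]
  by_cases h1 : k ≤ (strictUpper w v).card
  · have hr : ((L.take k).toFinset ∩ (List.ofFn t).toFinset).card = 0 := by
      rw [Finset.card_eq_zero, ← Finset.disjoint_iff_inter_eq_empty]
      exact Finset.disjoint_of_subset_left (hJ.subset_of_le_card strictUpper_isUpper h1)
        (disjoint_strictUpper hT)
    rw [candidateLists, hr, if_pos (Nat.succ_pos m)]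
    simp [Timed.choose]
  · have hr : ((L.take k).toFinset ∩ (List.ofFn t).toFinset).card = m + 1 := by
      rw [Finset.inter_eq_right.2 (Finset.union_subset_iff.1 (hJ.superset_of_card_le
        (strictUpper_union_isUpper hT) ?_)).2, hTcard]
      rw [Finset.card_union_of_disjoint (disjoint_strictUpper hT), hTcard]
      omega
    rw [candidateLists, hr, if_neg (lt_irrefl _)]
    simp

theorem isTopK_of_mem_candidateLists (ht : Function.Injective t)
    (hT : ∀ i, i ∈ (List.ofFn t).toFinset ↔ |w i| = v)
    (hL : L.Perm (List.finRange n)) (hs : L.Pairwise fun i j => |w j| ≤ |w i|) (hk : k ≤ n)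
    {l : List (Fin n)}
    (hl : l ∈ candidateLists t k L ((L.take k).countP fun x => decide (x ∈ List.ofFn t))) :
    IsTopK k w l.toFinset := by
  by_cases h : (strictUpper w v).card < k ∧ k < (strictUpper w v).card + (m + 1)
  · obtain ⟨M, hM, hcard, hS⟩ :=
      (exists_mem_candidateLists_iff_of_lt ht hT hL hs hk h.1 h.2 _).1 ⟨l, hl, rfl⟩
    exact hS ▸ isTopK_strictUpper_union hT h.1.le hM hcard
  · exact (exists_mem_candidateLists_iff_of_not_lt ht hT hL hs hk h _).1 ⟨l, hl, rfl⟩ ▸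
      isTopK_take hL hs hk

/-- A threshold set lies between U and U ∪ T. When the cut is not strictly inside T, its cardinality
forces it to be one of these two ends, and the same holds for the prefix. -/
theorem exists_mem_candidateLists_of_isThreshold (ht : Function.Injective t)
    (hT : ∀ i, i ∈ (List.ofFn t).toFinset ↔ |w i| = v)
    (hL : L.Perm (List.finRange n)) (hs : L.Pairwise fun i j => |w j| ≤ |w i|) (hk : k ≤ n)
    {I : Finset (Fin n)} (hI : IsThreshold w I v) (hcard : I.card = k) :
    ∃ l ∈ candidateLists t k L ((L.take k).countP fun x => decide (x ∈ List.ofFn t)),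
      l.toFinset = I := by
  have hTcard : (List.ofFn t).toFinset.card = m + 1 := by
    rw [List.toFinset_card_of_nodup (List.nodup_ofFn.2 ht), List.length_ofFn]
  have h1 := hI.strictUpper_subset
  have h2 := hI.subset_union hT
  by_cases h : (strictUpper w v).card < k ∧ k < (strictUpper w v).card + (m + 1)
  · refine (exists_mem_candidateLists_iff_of_lt ht hT hL hs hk h.1 h.2 _).2
      ⟨I \ strictUpper w v, fun i hi => ?_, ?_, Finset.union_sdiff_of_subset h1⟩
    · obtain ⟨hi1, hi2⟩ := Finset.mem_sdiff.1 hi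
      exact (Finset.mem_union.1 (h2 hi1)).resolve_left hi2
    · rw [Finset.card_sdiff_of_subset h1, hcard]
  · refine (exists_mem_candidateLists_iff_of_not_lt ht hT hL hs hk h _).2 ?_
    have hJ := isTopK_take hL hs hk
    by_cases h3 : k ≤ (strictUpper w v).card
    · have e : strictUpper w v = I := Finset.eq_of_subset_of_card_le h1 (hcard.trans_le h3)
      rw [← e] at hcard ⊢
      exact Finset.eq_of_subset_of_card_le (hJ.subset_of_le_card strictUpper_isUpper h3)
        (by rw [hJ.1, hcard])
    · have hu : (strictUpper w v ∪ (List.ofFn t).toFinset).card ≤ k := by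
        rw [Finset.card_union_of_disjoint (disjoint_strictUpper hT), hTcard]
        omega
      have e : I = strictUpper w v ∪ (List.ofFn t).toFinset :=
        Finset.eq_of_subset_of_card_le h2 (hu.trans_eq hcard.symm)
      rw [e] at hcard ⊢
      exact (Finset.eq_of_subset_of_card_le
        (hJ.superset_of_card_le (strictUpper_union_isUpper hT) hu) (by rw [hJ.1, hcard])).symm

theorem card_candidateLists_le (ht : Function.Injective t)
    (hT : ∀ i, i ∈ (List.ofFn t).toFinset ↔ |w i| = v)
    (hL : L.Perm (List.finRange n)) (hs : L.Pairwise fun i j => |w j| ≤ |w i|) (hk : k ≤ n) :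
    ((candidateLists t k L ((L.take k).countP fun x => decide (x ∈ List.ofFn t))).map
      List.toFinset).toFinset.card ≤ (m + 1).choose ((m + 2) / 2) := by
  have hTcard : (List.ofFn t).toFinset.card = m + 1 := by
    rw [List.toFinset_card_of_nodup (List.nodup_ofFn.2 ht), List.length_ofFn]
  by_cases h : (strictUpper w v).card < k ∧ k < (strictUpper w v).card + (m + 1)
  · have key := exists_mem_candidateLists_iff_of_lt ht hT hL hs hk h.1 h.2
    refine (Finset.card_le_card (t := ((List.ofFn t).toFinset.powersetCard
      (k - (strictUpper w v).card)).image (strictUpper w v ∪ ·)) fun S hS => ?_).trans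
      (Finset.card_image_le.trans ?_)
    · rw [List.mem_toFinset, List.mem_map] at hS
      obtain ⟨M, h1, h2, h3⟩ := (key S).1 hS
      exact Finset.mem_image.2 ⟨M, Finset.mem_powersetCard.2 ⟨h1, h2⟩, h3⟩
    · rw [Finset.card_powersetCard, hTcard]
      refine (Nat.choose_le_middle _ _).trans_eq ?_
      -- The middle coefficient is taken at ⌊d/2⌋, the bound at ⌈d/2⌉; they agree by symmetry.
      rw [← Nat.choose_symm_of_eq_add (show m + 1 = (m + 1) / 2 + (m + 2) / 2 by omega)]
  · have key := exists_mem_candidateLists_iff_of_not_lt ht hT hL hs hk h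
    refine (Finset.card_le_card (t := {(L.take k).toFinset}) fun S hS => ?_).trans ?_
    · rw [List.mem_toFinset, List.mem_map] at hS
      exact Finset.mem_singleton.2 ((key S).1 hS).symm
    · rw [Finset.card_singleton]
      exact Nat.choose_pos (by omega)

end LevelSet

/-! ### Characterization and size of the candidate set -/

/-- Any further index on the level of `t` would make `d + 1` ties. -/
theorem mem_levelSet_iff {n m : ℕ} {V : Matrix (Fin n) (Fin (m + 1)) ℝ}
    (hG : InGeneralPosition V) {t : Fin (m + 1) → Fin n} (ht : Function.Injective t)
    {c : Fin (m + 1) → ℝ} (hc : c ≠ 0) (htie : ∀ i, |(V *ᵥ c) (t i)| = |(V *ᵥ c) (t 0)|)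
    (i : Fin n) :
    i ∈ (List.ofFn t).toFinset ↔ |(V *ᵥ c) i| = |(V *ᵥ c) (t 0)| := by
  rw [List.mem_toFinset, List.mem_ofFn]
  constructor
  · rintro ⟨j, rfl⟩
    exact htie j
  · intro h
    by_contra hi
    refine hG (Fin.cons i t) (Fin.cons_injective_iff.2 ⟨hi, ht⟩) c hc fun j => ?_
    refine Fin.cases rfl (fun j => ?_) j
    simp only [Fin.cons_succ, Fin.cons_zero]
    rw [htie, h]

theorem mem_candidateSet {n m k : ℕ} (V : Matrix (Fin n) (Fin (m + 1)) ℝ) (I : Finset (Fin n)) :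
    I ∈ candidateSet V k ↔ ∃ t ∈ (Timed.choose (m + 1) (List.finRange n)).val,
      ∃ b ∈ (Timed.signs m).val, ∃ l ∈ (spannogramBody V k t b).val, l.toFinset = I := by
  simp only [candidateSet, spannogram, Timed.bind_val, Timed.flatMap_val, Timed.indices_val,
    List.mem_toFinset, List.mem_map, List.mem_flatMap]
  constructor
  · rintro ⟨l, ⟨t, ht, b, hb, hl⟩, rfl⟩
    exact ⟨t, ht, b, hb, l, hl, rfl⟩
  · rintro ⟨t, ht, b, hb, l, hl, rfl⟩
    exact ⟨l, ⟨t, ht, b, hb, hl⟩, rfl⟩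

theorem abs_mulVec_smul {n d : ℕ} (V : Matrix (Fin n) (Fin d) ℝ) (s : ℝ) (c : Fin d → ℝ)
    (i : Fin n) : |(V *ᵥ (s • c)) i| = |s| * |(V *ᵥ c) i| := by
  rw [Matrix.mulVec_smul, Pi.smul_apply, smul_eq_mul, abs_mul]

theorem IsTopK.smul {n d k : ℕ} {V : Matrix (Fin n) (Fin d) ℝ} {c : Fin d → ℝ}
    {I : Finset (Fin n)} (h : IsTopK k (V *ᵥ c) I) (s : ℝ) : IsTopK k (V *ᵥ (s • c)) I := by
  refine ⟨h.1, fun i hi j hj => ?_⟩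
  rw [abs_mulVec_smul, abs_mulVec_smul]
  exact mul_le_mul_of_nonneg_left (h.2 i hi j hj) (abs_nonneg s)

theorem exists_unit_smul {d : ℕ} {c : Fin d → ℝ} (hc : c ≠ 0) :
    ∃ s : ℝ, 0 < s ∧ (s • c) ⬝ᵥ (s • c) = 1 := by
  have h : 0 < c ⬝ᵥ c := lt_of_le_of_ne (Finset.sum_nonneg fun i _ => mul_self_nonneg _)
    (fun h => hc (dotProduct_self_eq_zero.1 h.symm))
  refine ⟨(Real.sqrt (c ⬝ᵥ c))⁻¹, inv_pos.2 (Real.sqrt_pos.2 h), ?_⟩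
  rw [smul_dotProduct, dotProduct_smul, smul_smul, ← mul_inv, Real.mul_self_sqrt h.le,
    smul_eq_mul, inv_mul_cancel₀ h.ne']

/-- The candidates are exactly the sets of `k` largest entries of nonzero vectors of the span. -/
theorem mem_candidateSet_iff {n m k : ℕ} (hk : 1 ≤ k) (hkn : k ≤ n)
    {V : Matrix (Fin n) (Fin (m + 1)) ℝ} (hV : V.rank = m + 1) (hG : InGeneralPosition V)
    (I : Finset (Fin n)) :
    I ∈ candidateSet V k ↔ ∃ c : Fin (m + 1) → ℝ, c ≠ 0 ∧ IsTopK k (V *ᵥ c) I := by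
  rw [mem_candidateSet]
  constructor
  · rintro ⟨t, ht, b, hb, l, hl, rfl⟩
    have ht := Timed.injective_of_mem_choose (List.nodup_finRange n) ht
    have hb := (Timed.mem_signs m b).1 hb
    have hz := nullVector_tieMatrix_ne_zero hV hG ht hb
    obtain ⟨L, hL, hs, hval⟩ := spannogramBody_val V k t b
    rw [hval] at hl
    exact ⟨_, hz, isTopK_of_mem_candidateLists ht (mem_levelSet_iff hG ht hz
      (abs_eq_of_tie hb (Timed.row_dotProduct_nullVector _))) hL hs hkn hl⟩
  · rintro ⟨c, hc, hI⟩
    obtain ⟨c', hc', S, hS, v, hv, hthr⟩ := exists_tie (by omega) hk hV hG hc hI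
    obtain ⟨t, htmem, htS⟩ := (Timed.exists_mem_choose_iff (List.nodup_finRange n) S).2
      ⟨fun i _ => by simp, hS⟩
    have ht := Timed.injective_of_mem_choose (List.nodup_finRange n) htmem
    have hv' : ∀ i, |(V *ᵥ c') (t i)| = v := fun i => hv _ (by
      rw [← htS, List.mem_toFinset, List.mem_ofFn]
      exact ⟨i, rfl⟩)
    obtain ⟨b, hb, s, hs0, hs⟩ := exists_signs_of_tie hV hG ht hc' fun i => by rw [hv', hv']
    have hz := nullVector_tieMatrix_ne_zero hV hG ht hb
    obtain ⟨L, hL, hsort, hval⟩ := spannogramBody_val V k t b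
    refine ⟨t, htmem, b, (Timed.mem_signs m b).2 hb, ?_⟩
    rw [hval]
    have hspos := abs_pos.2 hs0
    refine exists_mem_candidateLists_of_isThreshold ht (mem_levelSet_iff hG ht hz
      (abs_eq_of_tie hb (Timed.row_dotProduct_nullVector _))) hL hsort hkn ?_ hI.1
    -- The tied vector is `s` times the computed one, so its threshold is divided by |s|.
    have hvt := hv' 0
    rw [hs, abs_mulVec_smul] at hvt
    refine ⟨fun i hi => ?_, fun j hj => ?_⟩
    · have := hthr.1 i hi
      rw [hs, abs_mulVec_smul, ← hvt] at this
      exact le_of_mul_le_mul_left this hspos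
    · have := hthr.2 j hj
      rw [hs, abs_mulVec_smul, ← hvt] at this
      exact le_of_mul_le_mul_left this hspos

theorem card_toFinset_flatMap_le {α β : Type} [DecidableEq β] (f : α → List β) (l : List α)
    (K : ℕ) (h : ∀ x ∈ l, (f x).toFinset.card ≤ K) :
    (l.flatMap f).toFinset.card ≤ l.length * K := by
  induction l with
  | nil => simp
  | cons x l ih =>
    rw [List.flatMap_cons, List.toFinset_append, List.length_cons, Nat.succ_mul, add_comm]
    exact (Finset.card_union_le _ _).trans (Nat.add_le_add (h x List.mem_cons_self)
      (ih fun y hy => h y (List.mem_cons_of_mem _ hy)))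

theorem card_candidateSet_le {n m k : ℕ} (hkn : k ≤ n)
    {V : Matrix (Fin n) (Fin (m + 1)) ℝ} (hV : V.rank = m + 1) (hG : InGeneralPosition V) :
    (candidateSet V k).card ≤ 2 ^ m * (m + 1).choose ((m + 2) / 2) * n.choose (m + 1) := by
  have hrw : candidateSet V k = ((Timed.choose (m + 1) (List.finRange n)).val.flatMap fun t =>
      (Timed.signs m).val.flatMap fun b =>
        (spannogramBody V k t b).val.map List.toFinset).toFinset := by
    simp only [candidateSet, spannogram, Timed.bind_val, Timed.flatMap_val, Timed.indices_val,
      List.map_flatMap]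
  rw [hrw]
  refine (card_toFinset_flatMap_le _ _ (2 ^ m * (m + 1).choose ((m + 2) / 2))
    fun t ht => ?_).trans_eq ?_
  · refine (card_toFinset_flatMap_le _ _ ((m + 1).choose ((m + 2) / 2)) fun b hb => ?_).trans_eq ?_
    · have ht := Timed.injective_of_mem_choose (List.nodup_finRange n) ht
      have hb := (Timed.mem_signs m b).1 hb
      have hz := nullVector_tieMatrix_ne_zero hV hG ht hb
      obtain ⟨L, hL, hs, hval⟩ := spannogramBody_val V k t b
      rw [hval]
      exact card_candidateLists_le ht (mem_levelSet_iff hG ht hz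
        (abs_eq_of_tie hb (Timed.row_dotProduct_nullVector _))) hL hs hkn
    · rw [Timed.signs_length]
  · rw [Timed.choose_length, List.length_finRange, mul_comm]

/-! ### Sparse maximization of the quadratic form -/

section Sparse

variable {n d k : ℕ} {V : Matrix (Fin n) (Fin d) ℝ}

theorem dotProduct_mulVec_eq (V : Matrix (Fin n) (Fin d) ℝ) (y : Fin n → ℝ) (c : Fin d → ℝ) :
    y ⬝ᵥ (V *ᵥ c) = (Vᵀ *ᵥ y) ⬝ᵥ c := by
  rw [Matrix.dotProduct_mulVec, Matrix.mulVec_transpose]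

theorem quadForm_mul_transpose (V : Matrix (Fin n) (Fin d) ℝ) (x : Fin n → ℝ) :
    quadForm (V * Vᵀ) x = (Vᵀ *ᵥ x) ⬝ᵥ (Vᵀ *ᵥ x) := by
  rw [quadForm, ← Matrix.mulVec_mulVec, dotProduct_mulVec_eq]

theorem dotProduct_sq_le {m : ℕ} (a b : Fin m → ℝ) : (a ⬝ᵥ b) ^ 2 ≤ (a ⬝ᵥ a) * (b ⬝ᵥ b) := by
  simpa only [dotProduct, sq] using Finset.sum_mul_sq_le_sq_mul_sq Finset.univ a b

theorem dotProduct_self_pos_of_ne_zero {m : ℕ} {a : Fin m → ℝ} (ha : a ≠ 0) : 0 < a ⬝ᵥ a :=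
  lt_of_le_of_ne (Finset.sum_nonneg fun _ _ => mul_self_nonneg _)
    fun h => ha (dotProduct_self_eq_zero.1 h.symm)

theorem mem_suppOf {x : Fin n → ℝ} {i : Fin n} : i ∈ suppOf x ↔ x i ≠ 0 := by
  simp [suppOf]

theorem suppOf_smul {s : ℝ} (hs : s ≠ 0) (x : Fin n → ℝ) : suppOf (s • x) = suppOf x := by
  ext i
  simp [mem_suppOf, hs]

theorem exists_row_ne_zero (hd : 1 ≤ d) (hV : V.rank = d) : ∃ i, V i ≠ 0 := by
  by_contra! h
  obtain rfl : V = 0 := funext h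
  rw [Matrix.rank_zero] at hV
  omega

/-- A quadratic form `V Vᵀ` of positive rank is positive somewhere on the sparse sphere. -/
theorem exists_quadForm_pos (hd : 1 ≤ d) (hk : 1 ≤ k) (hkn : k ≤ n) (hV : V.rank = d) :
    ∃ y ∈ sparseSphere n k, 0 < quadForm (V * Vᵀ) y := by
  suffices h : ∃ y : Fin n → ℝ, (suppOf y).card = k ∧ Vᵀ *ᵥ y ≠ 0 by
    obtain ⟨y, hy, hVy⟩ := h
    have hy0 : y ≠ 0 := by
      rintro rfl
      exact hVy (Matrix.mulVec_zero _)
    obtain ⟨s, hs, hs1⟩ := exists_unit_smul hy0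
    refine ⟨s • y, ⟨hs1, by rw [suppOf_smul hs.ne', hy]⟩, ?_⟩
    rw [quadForm_mul_transpose]
    refine dotProduct_self_pos_of_ne_zero ?_
    rw [Matrix.mulVec_smul]
    exact smul_ne_zero hs.ne' hVy
  by_contra! h
  obtain ⟨i, hi⟩ := exists_row_ne_zero hd hV
  obtain ⟨K, hK, hKk⟩ := Finset.exists_superset_card_eq (s := {i}) (n := k) (by simpa using hk)
    (by simpa using hkn)
  have hiK : i ∈ K := hK (Finset.mem_singleton_self i)
  -- Both `a` and `a + Pi.single i 1` have support `K`, and they differ by a unit vector that Vᵀ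
  -- sends to the nonzero row `V i`; so Vᵀ cannot kill both.
  set a : Fin n → ℝ := fun j => if j ∈ K then 1 else 0 with ha
  have h1 := h a (by
    rw [← hKk]; congr 1; ext j; simp [mem_suppOf, ha])
  have h2 := h (a + Pi.single i 1) (by
    rw [← hKk]; congr 1; ext j
    rw [mem_suppOf, Pi.add_apply]
    by_cases hj : j = i
    · subst hj
      simp [ha, hiK]
    · simp [ha, Pi.single_eq_of_ne hj])
  rw [Matrix.mulVec_add, h1, zero_add, Matrix.mulVec_single_one] at h2
  exact hi h2

/-- Moving the entry at `i` to the position `j`, with a sign that makes the inner product with `w`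
as large as possible. -/
theorem exists_sparseSphere_swap {x w : Fin n → ℝ} (hx : x ∈ sparseSphere n k) {i j : Fin n}
    (hi : i ∈ suppOf x) (hj : j ∉ suppOf x) (hij : |w i| < |w j|) :
    ∃ y ∈ sparseSphere n k, x ⬝ᵥ w < y ⬝ᵥ w := by
  have hxi := mem_suppOf.1 hi
  have hxj : x j = 0 := by simpa [mem_suppOf] using hj
  have hne : i ≠ j := fun h => hj (h ▸ hi)
  obtain ⟨s, hs, hsw⟩ : ∃ s : ℝ, s * s = 1 ∧ s * x i * w j = |x i| * |w j| := by
    rw [← abs_mul]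
    rcases le_total 0 (x i * w j) with h | h
    · exact ⟨1, by norm_num, by rw [abs_of_nonneg h]; ring⟩
    · exact ⟨-1, by norm_num, by rw [abs_of_nonpos h]; ring⟩
  have hs0 : s ≠ 0 := by
    rintro rfl
    norm_num at hs
  set y : Fin n → ℝ := x - Pi.single i (x i) + Pi.single j (s * x i) with hy
  have hyw : ∀ u : Fin n → ℝ, y ⬝ᵥ u = x ⬝ᵥ u - x i * u i + s * x i * u j := fun u => by
    rw [hy, add_dotProduct, sub_dotProduct, single_dotProduct, single_dotProduct]
  have hyi : y i = 0 := by simp [hy, Pi.single_eq_of_ne hne]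
  have hyj : y j = s * x i := by simp [hy, Pi.single_eq_of_ne hne.symm, hxj]
  refine ⟨y, ⟨?_, ?_⟩, ?_⟩
  · rw [hyw, hyi, hyj, dotProduct_comm, hyw, hx.1, hxj]
    linear_combination (x i * x i) * hs
  · have : suppOf y = insert j ((suppOf x).erase i) := by
      ext l
      rw [mem_suppOf, Finset.mem_insert, Finset.mem_erase, mem_suppOf]
      by_cases hl : l = j
      · subst hl
        simp [hyj, hs0, hxi]
      · by_cases hl' : l = i
        · subst hl'
          simp [hyi, hl]
        · simp [hy, hl, hl']
    rw [this, Finset.card_insert_of_notMem (by simp [hj]), Finset.card_erase_of_mem hi, hx.2]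
    have := Finset.card_pos.2 ⟨i, hi⟩
    rw [hx.2] at this
    omega
  · rw [hyw, hsw]
    have h1 : x i * w i ≤ |x i| * |w i| := by rw [← abs_mul]; exact le_abs_self _
    have h2 : |x i| * |w i| < |x i| * |w j| := mul_lt_mul_of_pos_left hij (abs_pos.2 hxi)
    linarith

/-- The support of a sparse optimum `x` consists of `k` largest entries of `V Vᵀ x`. -/
theorem isTopK_suppOf (hd : 1 ≤ d) (hk : 1 ≤ k) (hkn : k ≤ n) (hV : V.rank = d) {x : Fin n → ℝ}
    (hx : x ∈ sparseSphere n k) (hmax : IsMaxOn (quadForm (V * Vᵀ)) (sparseSphere n k) x) :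
    Vᵀ *ᵥ x ≠ 0 ∧ IsTopK k (V *ᵥ (Vᵀ *ᵥ x)) (suppOf x) := by
  obtain ⟨y₀, hy₀, hpos⟩ := exists_quadForm_pos hd hk hkn hV
  have hq : 0 < quadForm (V * Vᵀ) x := hpos.trans_le (hmax hy₀)
  refine ⟨fun h => ?_, hx.2, fun i hi j hj => ?_⟩
  · rw [quadForm_mul_transpose, h, dotProduct_zero] at hq
    exact lt_irrefl _ hq
  · by_contra! hij
    obtain ⟨y, hy, hlt⟩ := exists_sparseSphere_swap hx hi hj hij
    rw [dotProduct_mulVec_eq V x, dotProduct_mulVec_eq V y, ← quadForm_mul_transpose] at hlt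
    -- The swap gives q(x) < Vᵀy · Vᵀx, while Cauchy–Schwarz and maximality bound the square of the
    -- right side by q(y) q(x) ≤ q(x)².
    have h1 := dotProduct_sq_le (Vᵀ *ᵥ y) (Vᵀ *ᵥ x)
    rw [← quadForm_mul_transpose, ← quadForm_mul_transpose] at h1
    have h2 : quadForm (V * Vᵀ) y ≤ quadForm (V * Vᵀ) x := hmax hy
    nlinarith

/-- Allowing fewer than `k` nonzero entries makes the set closed: the support condition defines a
finite union of coordinate subspaces. -/
theorem isCompact_sparse (n k : ℕ) :
    IsCompact {y : Fin n → ℝ | y ⬝ᵥ y = 1 ∧ (suppOf y).card ≤ k} := by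
  refine IsCompact.of_isClosed_subset
    (isCompact_univ_pi fun _ : Fin n => isCompact_Icc (a := (-1 : ℝ)) (b := 1)) ?_ ?_
  · refine IsClosed.inter (isClosed_eq (by unfold dotProduct; fun_prop) continuous_const) ?_
    have : {y : Fin n → ℝ | (suppOf y).card ≤ k} =
        ⋃ I ∈ {I : Finset (Fin n) | I.card ≤ k}, {y | ∀ i, i ∉ I → y i = 0} := by
      ext y
      simp only [Set.mem_ofPred_eq, Set.mem_iUnion, exists_prop]
      constructor
      · exact fun h => ⟨suppOf y, h, fun i hi => by simpa [mem_suppOf] using hi⟩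
      · rintro ⟨I, hI, h⟩
        refine (Finset.card_le_card fun i hi => ?_).trans hI
        by_contra hiI
        exact mem_suppOf.1 hi (h i hiI)
    change IsClosed {y : Fin n → ℝ | (suppOf y).card ≤ k}
    rw [this]
    refine Set.Finite.isClosed_biUnion (Set.toFinite _) fun I _ => ?_
    simp only [Set.ofPred_forall]
    exact isClosed_iInter fun i => isClosed_iInter fun _ =>
      isClosed_eq (continuous_apply i) continuous_const
  · rintro y ⟨hy, -⟩ i -
    have h : y i * y i ≤ y ⬝ᵥ y :=
      Finset.single_le_sum (f := fun i => y i * y i) (fun _ _ => mul_self_nonneg _)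
        (Finset.mem_univ i)
    rw [hy] at h
    exact abs_le.1 (abs_le_one_iff_mul_self_le_one.2 h)

/-- There is a set of `k` largest entries of `w` on which the sum of squares of `w` is maximal. -/
theorem exists_isTopK (hkn : k ≤ n) (w : Fin n → ℝ) :
    ∃ I, IsTopK k w I ∧
      ∀ K : Finset (Fin n), K.card ≤ k → ∑ i ∈ K, w i * w i ≤ ∑ i ∈ I, w i * w i := by
  obtain ⟨I, hI, hmax⟩ := (Finset.univ.powersetCard k).exists_max_image
    (fun I : Finset (Fin n) => ∑ i ∈ I, w i * w i)
    (Finset.powersetCard_nonempty.2 (by simpa using hkn))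
  have hIk := (Finset.mem_powersetCard.1 hI).2
  refine ⟨I, ⟨hIk, fun i hi j hj => ?_⟩, fun K hK => ?_⟩
  · by_contra! hij
    have h := hmax (insert j (I.erase i)) (Finset.mem_powersetCard.2 ⟨Finset.subset_univ _, by
      rw [Finset.card_insert_of_notMem (by simp [hj]), Finset.card_erase_of_mem hi, hIk]
      have := Finset.card_pos.2 ⟨i, hi⟩
      omega⟩)
    rw [Finset.sum_insert (by simp [hj]), ← Finset.add_sum_erase I _ hi] at h
    have := sq_lt_sq.2 hij
    rw [sq, sq] at this
    linarith
  · obtain ⟨K', hK', hcard⟩ := Finset.exists_superset_card_eq hK (by simpa using hkn)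
    exact (Finset.sum_le_sum_of_subset_of_nonneg hK' fun _ _ _ => mul_self_nonneg _).trans
      (hmax K' (Finset.mem_powersetCard.2 ⟨Finset.subset_univ _, hcard⟩))

/-- Some vector that is optimal among the unit vectors with at most `k` nonzero entries is supported
on `k` largest entries of a nonzero vector of the span. -/
theorem exists_sparse_optimum (hd : 1 ≤ d) (hk : 1 ≤ k) (hkn : k ≤ n) (hV : V.rank = d) :
    ∃ c : Fin d → ℝ, c ≠ 0 ∧ ∃ I, IsTopK k (V *ᵥ c) I ∧
      ∃ x : Fin n → ℝ, x ⬝ᵥ x = 1 ∧ suppOf x ⊆ I ∧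
        ∀ y : Fin n → ℝ, y ⬝ᵥ y = 1 → (suppOf y).card ≤ k →
          quadForm (V * Vᵀ) y ≤ quadForm (V * Vᵀ) x := by
  obtain ⟨y₀, hy₀, hpos⟩ := exists_quadForm_pos hd hk hkn hV
  have hcont : Continuous (quadForm (V * Vᵀ)) := by
    unfold quadForm
    exact continuous_id.dotProduct (continuous_const.matrix_mulVec continuous_id)
  obtain ⟨x, ⟨hx1, hxk⟩, hmax⟩ := (isCompact_sparse n k).exists_isMaxOn
    ⟨y₀, hy₀.1, hy₀.2.le⟩ hcont.continuousOn
  have hmax' : ∀ y : Fin n → ℝ, y ⬝ᵥ y = 1 → (suppOf y).card ≤ k →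
      quadForm (V * Vᵀ) y ≤ quadForm (V * Vᵀ) x := fun y h1 h2 => hmax ⟨h1, h2⟩
  have hQ : 0 < quadForm (V * Vᵀ) x := hpos.trans_le (hmax' y₀ hy₀.1 hy₀.2.le)
  have hc : Vᵀ *ᵥ x ≠ 0 := fun h => by
    rw [quadForm_mul_transpose, h, dotProduct_zero] at hQ
    exact lt_irrefl _ hQ
  set w := V *ᵥ (Vᵀ *ᵥ x) with hw
  obtain ⟨I, hI, hImax⟩ := exists_isTopK hkn w
  refine ⟨_, hc, I, hI, ?_⟩
  -- The new optimum is the normalized restriction of `w` to `I`.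
  set z : Fin n → ℝ := fun i => if i ∈ I then w i else 0 with hz
  have hzw : z ⬝ᵥ w = ∑ i ∈ I, w i * w i := by
    simp [hz, dotProduct, Finset.sum_ite_mem]
  have hzz : z ⬝ᵥ z = ∑ i ∈ I, w i * w i := by
    simp [hz, dotProduct, Finset.sum_ite_mem]
  have hxw : x ⬝ᵥ w = quadForm (V * Vᵀ) x := by
    rw [hw, dotProduct_mulVec_eq, ← quadForm_mul_transpose]
  -- Cauchy–Schwarz on the support of `x` for q(x) = x · w, followed by the maximality of `I`.
  have hle : quadForm (V * Vᵀ) x ^ 2 ≤ ∑ i ∈ I, w i * w i := by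
    have h1 : x ⬝ᵥ w = ∑ i ∈ suppOf x, x i * w i := by
      refine (Finset.sum_subset (Finset.subset_univ _) fun i _ hi => ?_).symm
      have : x i = 0 := by simpa [mem_suppOf] using hi
      rw [this, zero_mul]
    have h2 : ∑ i ∈ suppOf x, x i ^ 2 ≤ 1 := by
      rw [← hx1]
      simp only [dotProduct, ← sq]
      exact Finset.sum_le_sum_of_subset_of_nonneg (Finset.subset_univ _) fun _ _ _ => sq_nonneg _
    have h3 := Finset.sum_mul_sq_le_sq_mul_sq (suppOf x) x w
    rw [← h1, hxw] at h3
    refine h3.trans ((mul_le_of_le_one_left (Finset.sum_nonneg fun _ _ => sq_nonneg _) h2).trans ?_)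
    simpa only [sq] using hImax _ hxk
  have hN : 0 < ∑ i ∈ I, w i * w i := (by positivity : (0 : ℝ) < _ ^ 2).trans_le hle
  have hz0 : z ≠ 0 := by
    intro h
    rw [h, dotProduct_zero] at hzz
    exact hN.ne hzz
  obtain ⟨s, hs, hs1⟩ := exists_unit_smul hz0
  refine ⟨s • z, hs1, ?_, fun y hy1 hyk => (hmax' y hy1 hyk).trans ?_⟩
  · rw [suppOf_smul hs.ne']
    intro i hi
    by_contra hiI
    exact mem_suppOf.1 hi (by simp [hz, hiI])
  · have h1 := dotProduct_sq_le (Vᵀ *ᵥ (s • z)) (Vᵀ *ᵥ x)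
    rw [← dotProduct_mulVec_eq, ← hw, ← quadForm_mul_transpose, ← quadForm_mul_transpose,
      smul_dotProduct, hzw, smul_eq_mul] at h1
    rw [smul_dotProduct, dotProduct_smul, hzz, smul_eq_mul, smul_eq_mul] at hs1
    have h2 : (s * ∑ i ∈ I, w i * w i) ^ 2 = ∑ i ∈ I, w i * w i := by
      linear_combination (∑ i ∈ I, w i * w i) * hs1
    rw [h2] at h1
    have h3 := hle.trans h1
    rw [sq] at h3
    exact le_of_mul_le_mul_right h3 hQ

end Sparse

theorem lemma1 (d : ℕ) (hd : 1 ≤ d) :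
    (∀ (n k : ℕ) (V : Matrix (Fin n) (Fin d) ℝ),
      1 ≤ k → k ≤ n → V.rank = d → InGeneralPosition V →
        -- the candidates are exactly the sets of `k` largest entries of vectors in the span
        (∀ I : Finset (Fin n), I ∈ candidateSet V k ↔
          ∃ c : Fin d → ℝ, c ⬝ᵥ c = 1 ∧ IsTopK k (V *ᵥ c) I) ∧
        -- the support of every `k`-sparse optimum is a candidate
        (∀ x ∈ sparseSphere n k,
          IsMaxOn (quadForm (V * Vᵀ)) (sparseSphere n k) x → suppOf x ∈ candidateSet V k) ∧
        -- some candidate supports a vector that is optimal even among vectors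
        -- with at most `k` nonzero entries
        (∃ I ∈ candidateSet V k, ∃ x : Fin n → ℝ, x ⬝ᵥ x = 1 ∧ suppOf x ⊆ I ∧
          ∀ y : Fin n → ℝ, y ⬝ᵥ y = 1 → (suppOf y).card ≤ k →
            quadForm (V * Vᵀ) y ≤ quadForm (V * Vᵀ) x) ∧
        -- the number of candidates
        (candidateSet V k).card ≤ 2 ^ (d - 1) * d.choose ((d + 1) / 2) * n.choose d ∧
        (candidateSet V k).card ≤ 2 ^ (2 * d) * n.choose d) ∧
    (∃ C : ℝ, ∀ (n k : ℕ) (V : Matrix (Fin n) (Fin d) ℝ),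
      1 ≤ k → k ≤ n → V.rank = d → InGeneralPosition V →
        ((candidateSet V k).card : ℝ) ≤ C * (n : ℝ) ^ d) ∧
    -- the running time of the algorithm, for every input
    (∃ C : ℝ, ∀ (n k : ℕ) (V : Matrix (Fin n) (Fin d) ℝ), 2 ≤ n → 1 ≤ k → k ≤ n →
        (spannogramTime V k : ℝ) ≤ C * (n : ℝ) ^ (d + 1) * Real.log n) := by
  obtain ⟨m, rfl⟩ : ∃ m, d = m + 1 := ⟨d - 1, by omega⟩
  refine ⟨fun n k V hk hkn hV hG => ?_,
    ⟨2 ^ m * (m + 1).choose ((m + 2) / 2), fun n k V _ hkn hV hG => ?_⟩, ?_⟩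
  · have hmem := mem_candidateSet_iff hk hkn hV hG
    refine ⟨fun I => (hmem I).trans ⟨?_, ?_⟩, fun x hx hmax => ?_, ?_, ?_, ?_⟩
    · rintro ⟨c, hc, hI⟩
      obtain ⟨s, -, hs⟩ := exists_unit_smul hc
      exact ⟨s • c, hs, hI.smul s⟩
    · rintro ⟨c, hc, hI⟩
      refine ⟨c, ?_, hI⟩
      rintro rfl
      simp at hc
    · exact (hmem _).2 ⟨_, isTopK_suppOf hd hk hkn hV hx hmax⟩
    · obtain ⟨c, hc, I, hI, hx⟩ := exists_sparse_optimum hd hk hkn hV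
      exact ⟨I, (hmem I).2 ⟨c, hc, hI⟩, hx⟩
    · exact card_candidateSet_le hkn hV hG
    · refine (card_candidateSet_le hkn hV hG).trans (Nat.mul_le_mul_right _ ?_)
      -- The binomial coefficient is at most 2^d, and 2^(d-1) · 2^d ≤ 2^(2d).
      refine (Nat.mul_le_mul_left _ (Nat.choose_le_two_pow _ _)).trans ?_
      rw [← pow_add]
      exact Nat.pow_le_pow_right (by norm_num) (by omega)
  · have h := (card_candidateSet_le hkn hV hG).trans
      (Nat.mul_le_mul_left _ (Nat.choose_le_pow n (m + 1)))
    exact_mod_cast h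
  · obtain ⟨C, hC⟩ := exists_spannogramTime_le (m + 1) hd
    exact ⟨C, fun n k V hn _ _ => hC n k V hn⟩
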